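/- Consider a word RAM with memory of $2^w$ cells of $w$ bits each, whose unit-cost instructions are constants, indirect loads and stores, addition, subtraction, multiplication, integer division, bitwise Boolean operations, shifts, comparisons with conditional jumps, and outputting one word. For a string $S[1..n]$ of $w$-bit words, a real $0<\tau\le 1$ and $1\le i\le j\le n$, a $\tau$-majority of $S[i..j]$ is an element $a$ that occurs at least $\tau\,(j-i+1)$ times in $S[i..j]$. (1) There are one fixed program $P$ and absolute constants $c_0,c_1,c_2$ such that for every $\tau\in(0,1]$, all $n\ge 0$ and $w$ with $2^w\ge c_0 n$ (that is, words of at least $\log_2 n+O(1)$ bits), and every string $S[1..n]$ of $w$-bit words, there is a data structure (depending on $S$, $\tau$ and $w$) of at most $c_1 n$ words, fitting in the memory, with the following property. When it is stored in memory and $P$ is started with endpoints $i\le j$ as input, then, whatever the remaining memory cells and registers contain, $P$ halts after at most $c_2/\tau$ steps, has output exactly the $\tau$-majorities of $S[i..j]$, each once, and leaves the data structure unchanged. In short, for a threshold $\tau$ fixed at preprocessing time, a string can be stored in $O(n)$ words so that parameterized range majority queries take $O(1/\tau)$ time, with constants independent of $\tau$. (2) This query time is worst-case optimal: for every $\tau\in(0,1]$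 and all $n,w$ with $1/\tau\le n\le 2^w$, there are a string $S[1..n]$ of $w$-bit words and a range $S[i..j]$ such that every computation of every program (with any memory contents) that starts with empty output and halts having output exactly the $\tau$-majorities of $S[i..j]$, each once, takes at least $1/(2\tau)$ steps. -/

import Mathlib

/-! ### A word RAM with `w`-bit words -/

/-- The contents of a machine word of `w` bits. -/
abbrev MWord (w : ℕ) : Type := BitVec w

/-- The unit-cost binary operations on words: arithmetic modulo `2 ^ w`, unsigned integer division,
bitwise Boolean operations and shifts. -/
inductive WOp where
  | add | sub | mul | div | and | or | xor | shl | shr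

/-- The value of a binary operation. -/
def WOp.eval {w : ℕ} : WOp → MWord w → MWord w → MWord w
  | .add, x, y => x + y
  | .sub, x, y => x - y
  | .mul, x, y => x * y
  | .div, x, y => x / y
  | .and, x, y => x &&& y
  | .or, x, y => x ||| y
  | .xor, x, y => x ^^^ y
  | .shl, x, y => x <<< y.toNat
  | .shr, x, y => x >>> y.toNat

/-- Instructions. The arguments `d`, `a`, `b` are register numbers, `l` is a program line. -/
inductive Instr where
  /-- `R[d] := k`, a constant (modulo `2 ^ w`) -/
  | const (d k : ℕ)
  /-- `R[d] := R[a] o R[b]` -/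
  | op (o : WOp) (d a b : ℕ)
  /-- `R[d] := M[R[a]]` -/
  | load (d a : ℕ)
  /-- `M[R[a]] := R[b]` -/
  | store (a b : ℕ)
  /-- go to line `l` -/
  | jmp (l : ℕ)
  /-- if `R[a] < R[b]` (as unsigned numbers), go to line `l` -/
  | jlt (a b l : ℕ)
  /-- if `R[a] = R[b]`, go to line `l` -/
  | jeq (a b l : ℕ)
  /-- append the word `R[a]` to the output -/
  | out (a : ℕ)
  /-- stop -/
  | halt

/-- A program is a finite list of instructions. It does not depend on the word length. -/
abbrev Program : Type := List Instr

/-- A configuration: program counter, registers, a memory of `2 ^ w` cells, and the output written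
so far. (A program mentions finitely many registers.) -/
@[ext] structure Config (w : ℕ) where
  pc : ℕ
  reg : ℕ → MWord w
  mem : MWord w → MWord w
  out : List (MWord w)

/-- The effect of one instruction. -/
def Instr.exec {w : ℕ} (c : Config w) : Instr → Config w
  | .const d k => { c with pc := c.pc + 1, reg := Function.update c.reg d (BitVec.ofNat w k) }
  | .op o d a b =>
      { c with pc := c.pc + 1, reg := Function.update c.reg d (o.eval (c.reg a) (c.reg b)) }
  | .load d a => { c with pc := c.pc + 1, reg := Function.update c.reg d (c.mem (c.reg a)) }
  | .store a b => { c with pc := c.pc + 1, mem := Function.update c.mem (c.reg a) (c.reg b) }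
  | .jmp l => { c with pc := l }
  | .jlt a b l => { c with pc := if (c.reg a).toNat < (c.reg b).toNat then l else c.pc + 1 }
  | .jeq a b l => { c with pc := if c.reg a = c.reg b then l else c.pc + 1 }
  | .out a => { c with pc := c.pc + 1, out := c.out ++ [c.reg a] }
  | .halt => c

/-- The instruction to be executed next (`halt` if the program counter has left the program). -/
def Program.current {w : ℕ} (P : Program) (c : Config w) : Instr := P.getD c.pc Instr.halt

/-- One step of computation. A halted configuration is left as it is. -/
def Program.step {w : ℕ} (P : Program) (c : Config w) : Config w := (P.current c).exec c

/-- The configuration after `t` steps. -/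
def Program.run {w : ℕ} (P : Program) (c : Config w) (t : ℕ) : Config w := (P.step)^[t] c

/-- The machine has stopped. -/
def Program.Halted {w : ℕ} (P : Program) (c : Config w) : Prop := P.current c = Instr.halt

/-! ### Parameterized range majority -/

/-- The number of occurrences of `a` in `S[i..j]`. -/
def occ {n w : ℕ} (S : Fin n → MWord w) (i j : Fin n) (a : MWord w) : ℕ :=
  ((Finset.Icc i j).filter (fun k => S k = a)).card

/-- `a` is a `τ`-majority of the (nonempty) range `S[i..j]`: its relative frequency in that range
is at least `τ`. -/
def IsRangeMajority {n w : ℕ} (τ : ℝ) (S : Fin n → MWord w) (i j : Fin n) (a : MWord w) : Prop :=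
  τ ≤ (occ S i j a : ℝ) / ((j : ℝ) - (i : ℝ) + 1)

/-- Started in `c`, the program has stopped after at most `t` steps, and its output lists
the `τ`-majorities of `S[i..j]`, all of them, each once, and nothing else. -/
def Program.AnswersWithin {n w : ℕ} (P : Program) (c : Config w) (t : ℕ)
    (τ : ℝ) (S : Fin n → MWord w) (i j : Fin n) : Prop :=
  P.Halted (P.run c t) ∧ (P.run c t).out.Nodup ∧
    ∀ a : MWord w, a ∈ (P.run c t).out ↔ IsRangeMajority τ S i j a

/-- The first `D.length` memory cells hold the words of `D`. -/
def Config.Stores {w : ℕ} (c : Config w) (D : List (MWord w)) : Prop :=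
  ∀ (k : ℕ) (hk : k < D.length), c.mem (BitVec.ofNat w k) = D[k]

/-- A configuration in which a query with endpoints `i`, `j` to the stored data structure `D` is
started: `i` and `j` are in registers `0` and `1`, and nothing has been output. All the other
registers and all memory cells outside `D` may hold anything. -/
structure Config.IsQuery {w : ℕ} (c : Config w) (D : List (MWord w)) (i j : ℕ) : Prop where
  pc_eq : c.pc = 0
  out_eq : c.out = []
  reg_zero : c.reg 0 = BitVec.ofNat w i
  reg_one : c.reg 1 = BitVec.ofNat w j
  stores : c.Stores D

/-- With the data structure `D` in memory, the program `P` answers every `τ`-majority query on `S`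
within `T` steps, and leaves `D` intact. -/
def Program.SupportsRangeMajority {n w : ℕ} (P : Program) (D : List (MWord w))
    (τ : ℝ) (S : Fin n → MWord w) (T : ℝ) : Prop :=
  ∀ i j : Fin n, i ≤ j → ∀ c : Config w, c.IsQuery D i j →
    ∃ t : ℕ, (t : ℝ) ≤ T ∧ P.AnswersWithin c t τ S i j ∧ (P.run c t).Stores D

/-! Raise `τ` to at least `1 / n`, which changes no answer, and let `b` be `1 / τ` rounded up, so
that `b ≤ n`. Cut the string into buckets of `b` positions. For each range length the required
number of occurrences, minus one, is tabulated; call it `m`. A position `p` in the range certifies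
its symbol by two constant-time tests: the previous occurrence lies before `i`, and in the list of
all positions sorted by symbol the entry `m` places after `p` carries the same symbol and is at most
`j` (`leftmost_and_frequent_iff`). Only the leftmost occurrence of a majority passes, so nothing is
output twice.

The query tests directly the at most `b` positions before the next bucket boundary `u * b`. A
majority not found there has all its occurrences in `[u * b, j]`, hence relative frequency at least
`1 / b` there. Such shorter ranges are classed by length into dyadic levels `k`, and on level `k` at
most `2 ^ k` consecutive buckets form a block. Every majority of a range starting in a block is
frequent in a window of `3 * 2 ^ k * b` positions (`mem_candidates`), and only `6 * b` symbols are
(`card_candidates_le`); these are stored with the block.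

It remains to find the first occurrence of a candidate `a` from `u * b` on. Keep the positions that
are first in their bucket, sorted by symbol; the one sought is the entry at the rank of `(a, u *
b)`. A candidate stores the rank at the end of its block and a bitmap of the buckets of the block
containing `a`; subtracting the number of ones from the starting bucket on gives the rank wanted
(`popCount_slot`). Blocks are capped at `Nat.log 2 n + 1` buckets, so that bitmaps are small enough
to index a table of popcounts. The cap leaves the space linear (`blocksBelow_mul_le`). Correctness
is assembled in `reaches_answer`.

For the lower bound, `⌊1 / τ⌋` distinct symbols are all majorities of the range they fill, and a
step outputs at most one word. -/

/-! ### Counting in intervals of natural numbers -/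

open Classical in
/-- The number of elements of `[x, y)` satisfying `A`. -/
noncomputable def cnt (A : ℕ → Prop) (x y : ℕ) : ℕ := ((Finset.Ico x y).filter A).card

lemma cnt_congr {A B : ℕ → Prop} {x y : ℕ} (h : ∀ q, x ≤ q → q < y → (A q ↔ B q)) :
    cnt A x y = cnt B x y := by
  classical
  unfold cnt
  congr 1
  refine Finset.filter_congr fun q hq => ?_
  rw [Finset.mem_Ico] at hq
  exact h q hq.1 hq.2

lemma cnt_add {A : ℕ → Prop} {x y z : ℕ} (hxy : x ≤ y) (hyz : y ≤ z) :
    cnt A x y + cnt A y z = cnt A x z := by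
  classical
  unfold cnt
  rw [← Finset.Ico_union_Ico_eq_Ico hxy hyz, Finset.filter_union, Finset.card_union_of_disjoint]
  exact Finset.disjoint_filter_filter (Finset.Ico_disjoint_Ico_consecutive x y z)

lemma cnt_self (A : ℕ → Prop) (x : ℕ) : cnt A x x = 0 := by simp [cnt]

lemma cnt_pos {A : ℕ → Prop} {x y : ℕ} : 0 < cnt A x y ↔ ∃ q, x ≤ q ∧ q < y ∧ A q := by
  classical
  simp [cnt, Finset.card_pos, Finset.Nonempty, and_assoc]

lemma cnt_eq_zero {A : ℕ → Prop} {x y : ℕ} : cnt A x y = 0 ↔ ∀ q, x ≤ q → q < y → ¬ A q := by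
  rw [← not_iff_not, ← ne_eq, ← Nat.pos_iff_ne_zero, cnt_pos]
  push Not
  rfl

lemma cnt_le (A : ℕ → Prop) (x y : ℕ) : cnt A x y ≤ y - x := by
  classical
  exact (Finset.card_filter_le _ _).trans (by simp)

lemma cnt_mono {A : ℕ → Prop} {x x' y y' : ℕ} (hx : x' ≤ x) (hy : y ≤ y') :
    cnt A x y ≤ cnt A x' y' := by
  classical
  exact Finset.card_le_card (Finset.filter_subset_filter _ (Finset.Ico_subset_Ico hx hy))

lemma cnt_succ_right (A : ℕ → Prop) {x y : ℕ} (h : x ≤ y) [Decidable (A y)] :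
    cnt A x (y + 1) = cnt A x y + if A y then 1 else 0 := by
  classical
  rw [← cnt_add h y.le_succ]
  congr 1
  simp only [cnt, Nat.Ico_succ_singleton, Finset.filter_singleton]
  split_ifs <;> simp

/-- Among more than `k` elements there is one preceded by exactly `k`. -/
lemma exists_cnt_eq {A : ℕ → Prop} {x y k : ℕ} (h : k < cnt A x y) :
    ∃ q, x ≤ q ∧ q < y ∧ A q ∧ cnt A x q = k := by
  classical
  have hxy : x ≤ y := by
    by_contra hlt
    have := cnt_le A x y
    omega
  induction y, hxy using Nat.le_induction with
  | base => simp [cnt_self] at h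
  | succ y hy ih =>
    by_cases hk : k < cnt A x y
    · obtain ⟨q, h1, h2, h3⟩ := ih hk
      exact ⟨q, h1, h2.trans y.lt_succ_self, h3⟩
    · rw [cnt_succ_right A hy] at h
      split_ifs at h with hA
      · exact ⟨y, hy, y.lt_succ_self, hA, by omega⟩
      · omega

/-! ### Positions sorted by symbol -/

/-- In the list of the positions in `F` sorted by symbol and then by position, the index of the
first entry that is at least `(a, x)`. -/
noncomputable def classRank (n : ℕ) (F : ℕ → Prop) (S : ℕ → ℕ) (a x : ℕ) : ℕ :=
  cnt (fun q => F q ∧ S q < a) 0 n + cnt (fun q => F q ∧ S q = a) 0 x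

open Classical in
/-- The entry with index `y` of the list of the positions in `F` sorted by symbol and then by
position, and `n` if there is none. -/
noncomputable def classSelect (n : ℕ) (F : ℕ → Prop) (S : ℕ → ℕ) (y : ℕ) : ℕ :=
  if h : ∃ q, F q ∧ classRank n F S (S q) q = y then Nat.find h else n

section Rank

variable {n : ℕ} {F : ℕ → Prop} {S : ℕ → ℕ}

/-- In the sorted list every entry with symbol `a` precedes the first one with symbol `a'`. -/
lemma classRank_le_cnt_lt (hF : ∀ q, F q → q < n) {a a' : ℕ} (haa' : a < a') (x : ℕ) :
    classRank n F S a x ≤ cnt (fun q => F q ∧ S q < a') 0 n := by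
  classical
  unfold classRank cnt
  rw [← Finset.card_union_of_disjoint]
  · refine Finset.card_le_card fun q hq => ?_
    simp only [Finset.mem_union, Finset.mem_filter, Finset.mem_Ico] at hq ⊢
    rcases hq with ⟨h1, h2, h3⟩ | ⟨h1, h2, h3⟩
    · exact ⟨h1, h2, by omega⟩
    · exact ⟨⟨h1.1, hF q h2⟩, h2, by omega⟩
  · rw [Finset.disjoint_left]
    intro q h1 h2
    simp only [Finset.mem_filter] at h1 h2
    omega

lemma classRank_le (hF : ∀ q, F q → q < n) (a x : ℕ) : classRank n F S a x ≤ n :=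
  (classRank_le_cnt_lt hF a.lt_succ_self x).trans (by simpa using cnt_le _ 0 n)

lemma classRank_add {a x y : ℕ} (h : x ≤ y) :
    classRank n F S a x + cnt (fun q => F q ∧ S q = a) x y = classRank n F S a y := by
  unfold classRank
  rw [add_assoc, cnt_add (Nat.zero_le x) h]

lemma classRank_lt {a x q : ℕ} (h : q < x) (hq : F q) (ha : S q = a) :
    classRank n F S a q < classRank n F S a x := by
  rw [← classRank_add h.le]
  have : 0 < cnt (fun q => F q ∧ S q = a) q x := cnt_pos.2 ⟨q, le_rfl, h, hq, ha⟩
  omega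

/-- Entries with different symbols are separated by the start of the run of the larger symbol;
inside one run the rank grows strictly with the position. -/
lemma classRank_injOn (hF : ∀ q, F q → q < n) {q q' : ℕ} (hq : F q) (hq' : F q')
    (h : classRank n F S (S q) q = classRank n F S (S q') q') : q = q' := by
  have key : ∀ {q q' : ℕ}, F q → classRank n F S (S q) q = classRank n F S (S q') q' →
      ¬ S q < S q' := by
    intro q q' hq h hlt
    have h1 := classRank_le_cnt_lt hF hlt (q + 1) (S := S)
    have h2 := classRank_lt (n := n) q.lt_succ_self hq (rfl : S q = S q)
    have h3 : cnt (fun r => F r ∧ S r < S q') 0 n ≤ classRank n F S (S q') q' :=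
      Nat.le_add_right _ _
    simp only [Nat.succ_eq_add_one] at h2
    omega
  have hS : S q = S q' := by
    have h1 := key hq h
    have h2 := key hq' h.symm
    omega
  rcases lt_trichotomy q q' with hlt | heq | hlt
  · have := classRank_lt (n := n) hlt hq hS
    rw [hS] at h
    omega
  · exact heq
  · have := classRank_lt (n := n) hlt hq' hS.symm
    rw [← hS] at h
    omega

lemma classSelect_classRank (hF : ∀ q, F q → q < n) {q : ℕ} (hq : F q) :
    classSelect n F S (classRank n F S (S q) q) = q := by
  classical
  have h : ∃ q', F q' ∧ classRank n F S (S q') q' = classRank n F S (S q) q := ⟨q, hq, rfl⟩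
  rw [classSelect, dif_pos h]
  exact classRank_injOn hF (Nat.find_spec h).1 hq (Nat.find_spec h).2

lemma classSelect_le (hF : ∀ q, F q → q < n) (y : ℕ) : classSelect n F S y ≤ n := by
  classical
  unfold classSelect
  split_ifs with h
  · exact (hF _ (Nat.find_spec h).1).le
  · exact le_rfl

lemma classSelect_spec {y q : ℕ} (h : classSelect n F S y = q) (hq : q < n) :
    F q ∧ classRank n F S (S q) q = y := by
  classical
  unfold classSelect at h
  split_ifs at h with h'
  · rw [← h]
    exact Nat.find_spec h'
  · omega

/-- The run of `a` is contiguous in the sorted list, so moving `k` entries on either reaches the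
right occurrence or leaves the run, which the condition `S q = a` detects. This serves twice: with
all positions and `k = m` for the frequency test, and with bucketwise first occurrences and `k = 0`
to locate candidates. -/
lemma classSelect_eq_iff (hF : ∀ q, F q → q < n) {a x k q : ℕ} (hq : q < n) :
    classSelect n F S (classRank n F S a x + k) = q ∧ S q = a ↔
      F q ∧ S q = a ∧ x ≤ q ∧ cnt (fun r => F r ∧ S r = a) x q = k := by
  constructor
  · rintro ⟨h, ha⟩
    obtain ⟨h1, h2⟩ := classSelect_spec h hq
    rw [ha] at h2
    have hx : x ≤ q := by
      by_contra hlt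
      have := classRank_lt (n := n) (not_le.1 hlt) h1 ha
      omega
    have := classRank_add (n := n) (F := F) (S := S) (a := a) hx
    exact ⟨h1, ha, hx, by omega⟩
  · rintro ⟨h1, ha, hx, hk⟩
    refine ⟨?_, ha⟩
    rw [← hk, classRank_add hx, ← ha]
    exact classSelect_classRank hF h1

end Rank

/-! ### Testing a leftmost occurrence -/

open Classical in
/-- One more than the previous position holding the same symbol as `p`, and `0` if there is
none. -/
noncomputable def prevSucc (S : ℕ → ℕ) (p : ℕ) : ℕ :=
  ((Finset.range p).filter (fun q => S q = S p)).sup (· + 1)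

lemma prevSucc_le_iff {S : ℕ → ℕ} {p i : ℕ} :
    prevSucc S p ≤ i ↔ ∀ q, i ≤ q → q < p → S q ≠ S p := by
  classical
  simp only [prevSucc, Finset.sup_le_iff, Finset.mem_filter, Finset.mem_range, and_imp]
  constructor
  · intro h q hq hp he
    have := h q hp he
    omega
  · intro h q hp he
    by_contra hlt
    exact h q (by omega) hp he

lemma prevSucc_le_self (S : ℕ → ℕ) (p : ℕ) : prevSucc S p ≤ p :=
  prevSucc_le_iff.2 fun _ h h' => absurd h' (not_lt.2 h)

/-- The rank of position `p` in the order by symbol and position. -/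
noncomputable def posRank (n : ℕ) (S : ℕ → ℕ) (p : ℕ) : ℕ := classRank n (· < n) S (S p) p

/-- Position `p` is the first occurrence of its symbol in `[i, j]`, and the symbol occurs more
than `m` times. -/
lemma leftmost_and_frequent_iff {n : ℕ} {S : ℕ → ℕ} {i j p m : ℕ} (hip : i ≤ p) (hpj : p ≤ j)
    (hj : j < n) :
    (prevSucc S p ≤ i ∧ classSelect n (· < n) S (posRank n S p + m) ≤ j ∧
        S (classSelect n (· < n) S (posRank n S p + m)) = S p) ↔
      (∀ q, i ≤ q → q < p → S q ≠ S p) ∧ m < cnt (fun q => S q = S p) i (j + 1) := by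
  classical
  rw [prevSucc_le_iff]
  refine and_congr_right fun hleft => ?_
  -- Since `p` is leftmost, the occurrences in the whole range can be counted from `p` on.
  have h0 : cnt (fun q => S q = S p) i p = 0 := cnt_eq_zero.2 hleft
  rw [← cnt_add hip (by omega : p ≤ j + 1), h0, zero_add]
  have hc : ∀ q, q ≤ j → cnt (fun r => r < n ∧ S r = S p) p q = cnt (fun r => S r = S p) p q :=
    fun q hq => cnt_congr fun r _ hr => ⟨fun h => h.2, fun h => ⟨by omega, h⟩⟩
  constructor
  · rintro ⟨h1, h2⟩
    obtain ⟨-, h3, h4, h5⟩ := (classSelect_eq_iff (fun _ h => h) (lt_of_le_of_lt h1 hj)).1 ⟨rfl, h2⟩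
    rw [hc _ h1] at h5
    have := cnt_succ_right (fun r => S r = S p) h4
    rw [if_pos h3, h5] at this
    have := cnt_mono (A := fun r => S r = S p) (le_refl p)
      (by omega : classSelect n (· < n) S (posRank n S p + m) + 1 ≤ j + 1)
    omega
  · intro h
    obtain ⟨q, h1, h2, h3, h4⟩ := exists_cnt_eq h
    have hqj : q ≤ j := by omega
    obtain ⟨h5, -⟩ := (classSelect_eq_iff (F := (· < n)) (S := S) (a := S p) (x := p) (k := m)
      (fun _ h => h) (lt_of_le_of_lt hqj hj)).2 ⟨by omega, h3, h1, by rw [hc q hqj, h4]⟩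
    rw [posRank, h5]
    exact ⟨hqj, h3⟩

/-! ### Buckets -/

/-- Position `p` is the first occurrence of its symbol in its bucket of `b` positions. -/
def BucketFirst (n b : ℕ) (S : ℕ → ℕ) (p : ℕ) : Prop :=
  p < n ∧ ∀ q, q < p → q / b = p / b → S q ≠ S p

/-- The symbol `a` occurs in bucket `u`. -/
def BucketHas (n b : ℕ) (S : ℕ → ℕ) (a u : ℕ) : Prop := ∃ q, q < n ∧ q / b = u ∧ S q = a

lemma BucketFirst.exists_of_bucketHas {n b : ℕ} {S : ℕ → ℕ} {a u : ℕ}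
    (h : BucketHas n b S a u) : ∃ q, BucketFirst n b S q ∧ q / b = u ∧ S q = a := by
  classical
  refine ⟨Nat.find h, ⟨(Nat.find_spec h).1, fun q hq hb hS => Nat.find_min h hq ⟨?_, ?_, ?_⟩⟩,
    (Nat.find_spec h).2⟩
  · exact hq.trans (Nat.find_spec h).1
  · rw [hb, (Nat.find_spec h).2.1]
  · rw [hS, (Nat.find_spec h).2.2]

lemma BucketFirst.eq {n b : ℕ} {S : ℕ → ℕ} {p q : ℕ} (hp : BucketFirst n b S p)
    (hq : BucketFirst n b S q) (hb : p / b = q / b) (hS : S p = S q) : p = q := by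
  rcases lt_trichotomy p q with h | h | h
  · exact absurd hS (hq.2 p h hb)
  · exact h
  · exact absurd hS.symm (hp.2 q h hb.symm)

/-- Bucketwise first occurrences correspond to the buckets in which the symbol occurs. -/
lemma cnt_bucketFirst {n b : ℕ} (hb : 0 < b) {S : ℕ → ℕ} (a u v : ℕ) :
    cnt (fun q => BucketFirst n b S q ∧ S q = a) (u * b) (v * b) =
      cnt (BucketHas n b S a) u v := by
  classical
  unfold cnt
  refine Finset.card_bij (fun q _ => q / b) ?_ ?_ ?_
  · intro q hq
    simp only [Finset.mem_filter, Finset.mem_Ico] at hq ⊢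
    exact ⟨⟨(Nat.le_div_iff_mul_le hb).2 hq.1.1, (Nat.div_lt_iff_lt_mul hb).2 hq.1.2⟩,
      q, hq.2.1.1, rfl, hq.2.2⟩
  · intro p hp q hq h
    simp only [Finset.mem_filter] at hp hq
    exact hp.2.1.eq hq.2.1 h (hp.2.2.trans hq.2.2.symm)
  · intro x hx
    simp only [Finset.mem_filter, Finset.mem_Ico] at hx
    obtain ⟨q, h1, h2, h3⟩ := BucketFirst.exists_of_bucketHas hx.2
    refine ⟨q, ?_, h2⟩
    simp only [Finset.mem_filter, Finset.mem_Ico]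
    subst h2
    exact ⟨⟨(Nat.le_div_iff_mul_le hb).1 hx.1.1, (Nat.div_lt_iff_lt_mul hb).1 hx.1.2⟩, h1, h3⟩

/-- The first occurrence of a symbol after a bucket boundary is a first occurrence in its
bucket. -/
lemma bucketFirst_of_leftmost {n b : ℕ} {S : ℕ → ℕ} {u p : ℕ} (hp : p < n)
    (hup : u * b ≤ p) (h : ∀ q, u * b ≤ q → q < p → S q ≠ S p) : BucketFirst n b S p := by
  refine ⟨hp, fun q hq hb => h q ?_ hq⟩
  rcases Nat.eq_zero_or_pos b with rfl | hb0
  · simp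
  · rw [← Nat.le_div_iff_mul_le hb0, hb, Nat.le_div_iff_mul_le hb0]
    exact hup

/-! ### Bitmaps -/

/-- The number of ones among the last `β` bits of `y`. -/
noncomputable def popCount (β y : ℕ) : ℕ := cnt (fun u => y.testBit u = true) 0 β

open Classical in
/-- The word of `m` bits of which bit `u` tells whether `H u` holds. -/
noncomputable def bitmap (m : ℕ) (H : ℕ → Prop) : ℕ := Nat.ofBits fun u : Fin m => decide (H u)

lemma testBit_bitmap {m : ℕ} {H : ℕ → Prop} {u : ℕ} :
    (bitmap m H).testBit u = true ↔ u < m ∧ H u := by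
  classical
  by_cases hu : u < m
  · simp [bitmap, Nat.testBit_ofBits_lt _ _ hu, hu]
  · simp [bitmap, Nat.testBit_ofBits_ge _ _ (not_lt.1 hu), hu]

lemma bitmap_lt (m : ℕ) (H : ℕ → Prop) : bitmap m H < 2 ^ m := Nat.ofBits_lt_two_pow _

lemma popCount_zero (β : ℕ) : popCount β 0 = 0 := cnt_eq_zero.2 fun u _ _ => by simp

/-- Shifting by `t` discards the bits of the first `t` buckets, so one lookup counts a suffix of the
block. -/
lemma popCount_shift_bitmap {β m t s : ℕ} (hm : m ≤ β) (H : ℕ → Prop) :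
    popCount β (bitmap m (fun u => H (s + u)) >>> t) = cnt H (s + t) (s + m) := by
  classical
  unfold popCount cnt
  refine Finset.card_bij (fun u _ => s + t + u) ?_ ?_ ?_
  · intro u hu
    simp only [Finset.mem_filter, Finset.mem_Ico, Nat.testBit_shiftRight, testBit_bitmap] at hu ⊢
    exact ⟨by omega, by rw [add_assoc]; exact hu.2.2⟩
  · intro u _ v _ h
    omega
  · intro v hv
    simp only [Finset.mem_filter, Finset.mem_Ico] at hv
    obtain ⟨u, rfl⟩ := Nat.exists_eq_add_of_le hv.1.1
    refine ⟨u, ?_, rfl⟩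
    simp only [Finset.mem_filter, Finset.mem_Ico, Nat.testBit_shiftRight, testBit_bitmap]
    exact ⟨by omega, by omega, by rw [← add_assoc]; exact hv.2⟩

/-! ### Candidates -/

open Classical in
/-- The symbols that are frequent in the window `[s, s + 3 * 2 ^ k * b)`. -/
noncomputable def candidates (n b : ℕ) (S : ℕ → ℕ) (s k : ℕ) : Finset ℕ :=
  ((Finset.Ico s (s + 3 * 2 ^ k * b)).image S).filter fun a =>
    2 ^ k ≤ 2 * cnt (fun q => q < n ∧ S q = a) s (s + 3 * 2 ^ k * b)

/-- Candidates have disjoint sets of occurrences, each of size at least `2 ^ k / 2`, in a window of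
`3 * 2 ^ k * b` positions. -/
lemma card_candidates_le (n b : ℕ) (S : ℕ → ℕ) (s k : ℕ) :
    (candidates n b S s k).card ≤ 6 * b := by
  classical
  set W := Finset.Ico s (s + 3 * 2 ^ k * b) with hW
  have h1 : (candidates n b S s k).card * 2 ^ k ≤
      ∑ a ∈ candidates n b S s k, 2 * (W.filter fun q => S q = a).card := by
    rw [← smul_eq_mul]
    refine Finset.card_nsmul_le_sum _ _ _ fun a ha => ?_
    refine (Finset.mem_filter.1 ha).2.trans (Nat.mul_le_mul_left 2 ?_)
    refine Finset.card_le_card fun q hq => ?_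
    simp only [Finset.mem_filter] at hq ⊢
    exact ⟨hq.1, hq.2.2⟩
  have h2 : ∑ a ∈ candidates n b S s k, 2 * (W.filter fun q => S q = a).card ≤
      ∑ a ∈ W.image S, 2 * (W.filter fun q => S q = a).card :=
    Finset.sum_le_sum_of_subset (Finset.filter_subset _ _)
  rw [← Finset.mul_sum (W.image S), ← Finset.card_eq_sum_card_image, hW, Nat.card_Ico] at h2
  have h3 : (candidates n b S s k).card * 2 ^ k ≤ (6 * b) * 2 ^ k := by
    refine (h1.trans h2).trans (le_of_eq ?_)
    rw [Nat.add_sub_cancel_left]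
    ring
  exact Nat.le_of_mul_le_mul_right h3 (by positivity)

/-- A symbol with relative frequency at least `1 / b` in `[x, j]` is a candidate of any block in
which the range starts. -/
lemma mem_candidates {n b : ℕ} (hb : 0 < b) {S : ℕ → ℕ} {s x j a k : ℕ} (hj : j < n) (hxj : x ≤ j)
    (hk : k = Nat.log 2 ((j - x + 1) / b + 1)) (hs : s ≤ x) (hx : x < s + 2 ^ k * b)
    (hocc : 0 < cnt (fun q => S q = a) x (j + 1))
    (hfreq : j - x + 1 ≤ cnt (fun q => S q = a) x (j + 1) * b) :
    a ∈ candidates n b S s k := by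
  classical
  have hk1 : 2 ^ k ≤ (j - x + 1) / b + 1 := by
    rw [hk]
    exact Nat.pow_log_le_self 2 (Nat.succ_ne_zero _)
  have hk2 : (j - x + 1) / b + 1 < 2 ^ (k + 1) := by
    rw [hk]
    exact Nat.lt_pow_succ_log_self (by norm_num) _
  -- The range is shorter than two units of `2 ^ k * b` and starts within the first unit after `s`,
  -- so a window of three units contains it.
  have hlen : j - x + 1 < 2 * 2 ^ k * b := by
    have h1 : (j - x + 1) / b < 2 ^ (k + 1) - 1 := Nat.lt_sub_of_add_lt hk2
    rw [Nat.div_lt_iff_lt_mul hb] at h1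
    refine h1.trans_le (Nat.mul_le_mul_right b ?_)
    rw [pow_succ]
    omega
  have hsub : j + 1 ≤ s + 3 * 2 ^ k * b := by
    have h1 : 3 * 2 ^ k * b = 2 * 2 ^ k * b + 2 ^ k * b := by ring
    omega
  have hfreq' : (j - x + 1) / b ≤ cnt (fun q => S q = a) x (j + 1) :=
    Nat.div_le_of_le_mul (by rwa [mul_comm])
  obtain ⟨q, h1, h2, h3⟩ := cnt_pos.1 hocc
  refine Finset.mem_filter.2 ⟨Finset.mem_image.2 ⟨q, Finset.mem_Ico.2 ⟨hs.trans h1, by omega⟩, h3⟩, ?_⟩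
  have h4 : cnt (fun q => S q = a) x (j + 1) = cnt (fun q => q < n ∧ S q = a) x (j + 1) :=
    cnt_congr fun r _ hr => ⟨fun h => ⟨by omega, h⟩, fun h => h.2⟩
  have h5 := cnt_mono (A := fun q => q < n ∧ S q = a) hs hsub
  -- The count is at least `2 ^ k - 1` and at least `1`, hence at least half of `2 ^ k`; the
  -- positivity hypothesis matters when `k = 0`.
  omega

/-! ### Running straight-line code -/

/-- The instruction always passes control to the next line. -/
def Instr.isStraight : Instr → Bool
  | .const _ _ | .op _ _ _ _ | .load _ _ | .store _ _ | .out _ => true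
  | _ => false

lemma Instr.pc_exec {w : ℕ} {I : Instr} (h : I.isStraight = true) (c : Config w) :
    (I.exec c).pc = c.pc + 1 := by
  cases I <;> first | rfl | simp [Instr.isStraight] at h

/-- The effect of executing a list of instructions one after the other. -/
def Config.execList {w : ℕ} (c : Config w) (l : List Instr) : Config w :=
  l.foldl (fun c I => I.exec c) c

lemma Config.execList_cons {w : ℕ} (c : Config w) (I : Instr) (l : List Instr) :
    c.execList (I :: l) = (I.exec c).execList l := rfl

namespace Program

variable {w : ℕ} {P : Program}

lemma run_add (c : Config w) (s t : ℕ) : P.run c (s + t) = P.run (P.run c s) t := by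
  simp only [run, ← Function.iterate_add_apply, add_comm]

lemma run_succ (c : Config w) (t : ℕ) : P.run c (t + 1) = P.run (P.step c) t :=
  Function.iterate_succ_apply _ _ _

/-- Code that is straight up to its last instruction is executed from top to bottom. -/
lemma run_eq_execList (I : Instr) (l : List Instr) (c : Config w)
    (hl : (P.drop c.pc).take (l.length + 1) = l ++ [I]) (h : l.all Instr.isStraight = true) :
    P.run c (l.length + 1) = c.execList (l ++ [I]) := by
  induction l generalizing c with
  | nil =>
    have hget : P[c.pc]? = some I := by
      have := congrArg (·[0]?) hl
      simpa using this
    simp [run, step, current, hget, Config.execList]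
  | cons J l ih =>
    have hget : P[c.pc]? = some J := by
      have := congrArg (·[0]?) hl
      simpa using this
    have hstep : P.step c = J.exec c := by simp [step, current, hget]
    rw [List.all_cons, Bool.and_eq_true] at h
    rw [List.length_cons, run_succ, hstep, List.cons_append, Config.execList_cons]
    refine ih _ ?_ h.2
    rw [Instr.pc_exec h.1]
    have := congrArg (List.drop 1) hl
    rw [List.drop_take, List.drop_drop] at this
    simpa using this

/-- From `c` the configuration `c'` is reached in at most `T` steps. -/
def Reaches (P : Program) (c : Config w) (T : ℕ) (c' : Config w) : Prop :=
  ∃ t ≤ T, P.run c t = c'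

lemma Reaches.refl (c : Config w) (T : ℕ) : P.Reaches c T c := ⟨0, Nat.zero_le _, rfl⟩

lemma Reaches.trans {c c' c'' : Config w} {T T' : ℕ} (h : P.Reaches c T c')
    (h' : P.Reaches c' T' c'') : P.Reaches c (T + T') c'' := by
  obtain ⟨t, ht, rfl⟩ := h
  obtain ⟨t', ht', rfl⟩ := h'
  exact ⟨t + t', by omega, run_add c t t'⟩

lemma Reaches.mono {c c' : Config w} {T T' : ℕ} (h : P.Reaches c T c') (hT : T ≤ T') :
    P.Reaches c T' c' := by
  obtain ⟨t, ht, h⟩ := h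
  exact ⟨t, ht.trans hT, h⟩

lemma reaches_of_execList {c c' : Config w} {T : ℕ} (l : List Instr) (I : Instr)
    (hT : l.length + 1 = T) (hl : (P.drop c.pc).take (l.length + 1) = l ++ [I])
    (h : l.all Instr.isStraight = true) (hc : c.execList (l ++ [I]) = c') : P.Reaches c T c' :=
  ⟨l.length + 1, hT.le, (run_eq_execList I l c hl h).trans hc⟩

end Program

/-! ### The query program -/

/-- The program answering range majority queries. -/
def queryProgram : Program :=
  [ .const 22 0, .load 2 22, .const 21 1, .load 3 21, .const 22 2, .load 4 22,
    .op .add 5 2 2, .op .add 6 5 2, .op .add 7 6 2, .op .add 8 7 2, .op .add 9 8 2,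
    .op .add 10 9 2, .op .add 11 10 2, .op .add 12 11 2, .op .add 13 12 2,
    .op .sub 22 1 0, .op .add 22 22 8, .load 14 22, .const 20 0, .op .div 26 0 3,
    .op .add 26 26 21, .op .mul 26 26 3, .op .add 15 0 20,
    -- line 23: scan up to the end of the bucket
    .jeq 15 26 26, .jlt 1 15 78, .jmp 59,
    -- line 26: find the list of candidates
    .jlt 1 15 78, .op .sub 22 1 15, .op .add 23 22 9, .load 23 23, .op .add 22 22 10,
    .load 22 22, .op .div 24 15 23, .op .add 22 22 24, .op .mul 16 22 4, .op .add 16 16 13,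
    .op .add 17 16 4, .op .mul 24 24 23, .op .sub 24 15 24, .op .div 18 24 3, .const 20 1,
    -- line 41: go through the candidates
    .jeq 16 17 78, .load 19 16, .op .add 16 16 21, .load 22 16, .op .add 16 16 21, .load 23 16,
    .op .add 16 16 21, .op .shr 23 23 18, .op .add 23 23 12, .load 23 23, .op .sub 22 22 23,
    .op .add 22 22 11, .load 15 22, .jlt 1 15 41, .op .add 22 15 2, .load 22 22, .jeq 22 19 59,
    .jmp 41,
    -- line 59: test the position in register 15
    .op .add 22 15 5, .load 22 22, .jlt 0 22 75,
    .op .add 22 15 6, .load 22 22, .op .add 22 22 14, .op .add 22 22 7, .load 22 22, .jlt 1 22 75,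
    .op .add 22 22 2, .load 22 22, .op .add 23 15 2, .load 23 23, .jeq 22 23 74, .jmp 75,
    .out 23,
    -- line 75: next position or next candidate
    .jeq 20 21 41, .op .add 15 15 21, .jmp 23,
    .halt ]

/-! ### Memory layout and fixed registers -/

/-- The memory consists of ten tables of `M` cells each and an array of `Z` cells. -/
structure Layout {w : ℕ} (mem : MWord w → MWord w) (n M b Z : ℕ) (tab : ℕ → ℕ → ℕ)
    (cand : ℕ → ℕ) : Prop where
  tab_eq : ∀ f < 10, ∀ y < M, mem (BitVec.ofNat w (f * M + y)) = BitVec.ofNat w (tab f y)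
  cand_eq : ∀ z < Z, mem (BitVec.ofNat w (10 * M + z)) = BitVec.ofNat w (cand z)
  size_lt : 10 * M + Z < 2 ^ w
  size_ge : 2 * n + 2 ≤ M
  pos : 0 < n
  bucket_pos : 0 < b
  bucket_le : b ≤ n
  header_size : tab 0 0 = M
  header_bucket : tab 0 1 = b
  header_stride : tab 0 2 = 18 * b
  symbol_lt : ∀ y, tab 1 y < 2 ^ w
  prev_le : ∀ y < n, tab 2 y ≤ n
  rank_le : ∀ y < n, tab 3 y ≤ n
  select_le : ∀ y, tab 4 y ≤ n
  freq_le : ∀ y < n, tab 5 y ≤ n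
  width_pos : ∀ y < n, 0 < tab 6 y
  width_lt : ∀ y < n, tab 6 y < 2 ^ w
  bucketSelect_le : ∀ y, tab 8 y ≤ n

/-- The registers that stay fixed during a query. -/
structure Env {w : ℕ} (reg : ℕ → MWord w) (M b i j m : ℕ) : Prop where
  r0 : reg 0 = BitVec.ofNat w i
  r1 : reg 1 = BitVec.ofNat w j
  r2 : reg 2 = BitVec.ofNat w (1 * M)
  r3 : reg 3 = BitVec.ofNat w b
  r4 : reg 4 = BitVec.ofNat w (18 * b)
  r5 : reg 5 = BitVec.ofNat w (2 * M)
  r6 : reg 6 = BitVec.ofNat w (3 * M)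
  r7 : reg 7 = BitVec.ofNat w (4 * M)
  r8 : reg 8 = BitVec.ofNat w (5 * M)
  r9 : reg 9 = BitVec.ofNat w (6 * M)
  r10 : reg 10 = BitVec.ofNat w (7 * M)
  r11 : reg 11 = BitVec.ofNat w (8 * M)
  r12 : reg 12 = BitVec.ofNat w (9 * M)
  r13 : reg 13 = BitVec.ofNat w (10 * M)
  r14 : reg 14 = BitVec.ofNat w m
  r21 : reg 21 = BitVec.ofNat w 1

lemma Env.congr {w : ℕ} {reg reg' : ℕ → MWord w} {M b i j m : ℕ} (h : Env reg M b i j m)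
    (hr : ∀ r, r ≤ 14 ∨ r = 21 → reg' r = reg r) : Env reg' M b i j m := by
  constructor <;> rw [hr _ (by norm_num)]
  exacts [h.r0, h.r1, h.r2, h.r3, h.r4, h.r5, h.r6, h.r7, h.r8, h.r9, h.r10, h.r11, h.r12, h.r13,
    h.r14, h.r21]

lemma Layout.load {w : ℕ} {mem : MWord w → MWord w} {n M b Z : ℕ} {tab : ℕ → ℕ → ℕ}
    {cand : ℕ → ℕ} (hL : Layout mem n M b Z tab cand) (f : ℕ) {y : ℕ} (hf : f < 10) (hy : y < M) :
    mem (BitVec.ofNat w y + BitVec.ofNat w (f * M)) = BitVec.ofNat w (tab f y) := by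
  rw [← BitVec.ofNat_add, add_comm, hL.tab_eq f hf y hy]

/-- The condition tested from line 59 on. -/
def Accepts (tab : ℕ → ℕ → ℕ) (i j m p : ℕ) : Prop :=
  tab 2 p ≤ i ∧ tab 4 (tab 3 p + m) ≤ j ∧ tab 1 (tab 4 (tab 3 p + m)) = tab 1 p

lemma toNat_ofNat_of_lt {w x : ℕ} (h : x < 2 ^ w) : (BitVec.ofNat w x).toNat = x := by
  rw [BitVec.toNat_ofNat, Nat.mod_eq_of_lt h]

lemma ofNat_inj_of_lt {w x y : ℕ} (hx : x < 2 ^ w) (hy : y < 2 ^ w) :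
    BitVec.ofNat w x = BitVec.ofNat w y ↔ x = y := by
  rw [← BitVec.toNat_inj, toNat_ofNat_of_lt hx, toNat_ofNat_of_lt hy]

open Program

/-! ### Execution of the query program -/

section Query

variable {w n M b Z i j m : ℕ} {mem : MWord w → MWord w} {tab : ℕ → ℕ → ℕ} {cand : ℕ → ℕ}

open Classical in
lemma reaches_of_test (hL : Layout mem n M b Z tab cand) (hij : i ≤ j) (hj : j < n) (hm : m ≤ n)
    {c : Config w} (hpc : c.pc = 59) (hmem : c.mem = mem) (hE : Env c.reg M b i j m) {p : ℕ}
    (hp : c.reg 15 = BitVec.ofNat w p) (hpj : p ≤ j) :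
    ∃ c', queryProgram.Reaches c 16 c' ∧ c'.pc = 75 ∧ c'.mem = mem ∧
      (∀ r, r ≠ 22 → r ≠ 23 → c'.reg r = c.reg r) ∧
      c'.out = c.out ++ if Accepts tab i j m p then [BitVec.ofNat w (tab 1 p)] else [] := by
  have hM := hL.size_ge
  have hw := hL.size_lt
  have hpn : p < n := by omega
  have h2 := hL.prev_le p hpn
  have h3 := hL.rank_le p hpn
  have h4 := hL.select_le (tab 3 p + m)
  have hl2 := hL.load 2 (by norm_num) (by omega : p < M)
  have hl3 := hL.load 3 (by norm_num) (by omega : p < M)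
  -- The index can be as large as `2 * n`; this is why the tables have more than `2 * n` cells.
  have hl4 := hL.load 4 (by norm_num) (by omega : tab 3 p + m < M)
  have hl1 := hL.load 1 (by norm_num) (by omega : p < M)
  have hl1' := fun h : tab 4 (tab 3 p + m) ≤ j => hL.load 1 (by norm_num)
    (by omega : tab 4 (tab 3 p + m) < M)
  rw [BitVec.ofNat_add] at hl4
  have e0 := hE.r0
  have e1 := hE.r1
  have e2 := hE.r2
  have e5 := hE.r5
  have e6 := hE.r6
  have e7 := hE.r7
  have e14 := hE.r14
  simp only [one_mul] at hl1 hl1' e2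
  obtain ⟨pc, reg, mem', out⟩ := c
  simp only at hpc hmem hp e0 e1 e2 e5 e6 e7 e14
  subst hpc hmem
  have bi : (BitVec.ofNat w i).toNat = i := toNat_ofNat_of_lt (by omega)
  have bj : (BitVec.ofNat w j).toNat = j := toNat_ofNat_of_lt (by omega)
  have b2 : (BitVec.ofNat w (tab 2 p)).toNat = tab 2 p := toNat_ofNat_of_lt (by omega)
  have b4 : (BitVec.ofNat w (tab 4 (tab 3 p + m))).toNat = tab 4 (tab 3 p + m) :=
    toNat_ofNat_of_lt (by omega)
  have hr1 : queryProgram.Reaches ⟨59, reg, mem', out⟩ 3 ⟨if i < tab 2 p then 75 else 62,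
      Function.update reg 22 (BitVec.ofNat w (tab 2 p)), mem', out⟩ := by
    refine reaches_of_execList [.op .add 22 15 5, .load 22 22] (.jlt 0 22 75) rfl rfl rfl ?_
    simp [Config.execList, Instr.exec, WOp.eval, hp, e0, e5, hl2, -BitVec.toNat_ofNat, bi, b2]
  by_cases ht2 : tab 2 p ≤ i
  swap
  · rw [if_pos (not_le.1 ht2)] at hr1
    refine ⟨_, hr1.mono (by norm_num), rfl, rfl, fun r h _ => by simp [h], ?_⟩
    rw [if_neg fun h => ht2 h.1, List.append_nil]
  rw [if_neg (not_lt.2 ht2)] at hr1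
  set reg1 := Function.update reg 22 (BitVec.ofNat w (tab 2 p)) with hreg1
  have hr2 : queryProgram.Reaches ⟨62, reg1, mem', out⟩ 6
      ⟨if j < tab 4 (tab 3 p + m) then 75 else 68,
      Function.update reg 22 (BitVec.ofNat w (tab 4 (tab 3 p + m))), mem', out⟩ := by
    refine reaches_of_execList [.op .add 22 15 6, .load 22 22, .op .add 22 22 14,
      .op .add 22 22 7, .load 22 22] (.jlt 1 22 75) rfl rfl rfl ?_
    simp [Config.execList, Instr.exec, WOp.eval, hreg1, hp, e1, e6, e14, e7, hl3, hl4,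
      -BitVec.toNat_ofNat, bj, b4]
  have hr12 := hr1.trans hr2
  by_cases ht4 : tab 4 (tab 3 p + m) ≤ j
  swap
  · rw [if_pos (not_le.1 ht4)] at hr12
    refine ⟨_, hr12.mono (by norm_num), rfl, rfl, fun r h _ => by simp [h], ?_⟩
    rw [if_neg fun h => ht4 h.2.1, List.append_nil]
  rw [if_neg (not_lt.2 ht4)] at hr12
  specialize hl1' ht4
  set q := tab 4 (tab 3 p + m) with hq
  have hr3 : queryProgram.Reaches
      ⟨68, Function.update reg 22 (BitVec.ofNat w q), mem', out⟩ 5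
      ⟨if tab 1 q = tab 1 p then 74 else 73,
      Function.update (Function.update reg 22 (BitVec.ofNat w (tab 1 q))) 23
        (BitVec.ofNat w (tab 1 p)), mem', out⟩ := by
    refine reaches_of_execList [.op .add 22 22 2, .load 22 22, .op .add 23 15 2, .load 23 23] (.jeq 22 23 74) rfl rfl rfl ?_
    have := ofNat_inj_of_lt (hL.symbol_lt q) (hL.symbol_lt p)
    simp [Config.execList, Instr.exec, WOp.eval, hp, e2, hl1, hl1', this]
  have hr13 := hr12.trans hr3
  by_cases ht1 : tab 1 q = tab 1 p
  · rw [if_pos ht1] at hr13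
    have hr4 : queryProgram.Reaches ⟨74, Function.update (Function.update reg 22
        (BitVec.ofNat w (tab 1 q))) 23 (BitVec.ofNat w (tab 1 p)), mem', out⟩ 1
        ⟨75, Function.update (Function.update reg 22 (BitVec.ofNat w (tab 1 q))) 23
          (BitVec.ofNat w (tab 1 p)), mem', out ++ [BitVec.ofNat w (tab 1 p)]⟩ := by
      refine reaches_of_execList [] (.out 23) rfl rfl rfl ?_
      simp [Config.execList, Instr.exec]
    refine ⟨_, (hr13.trans hr4).mono (by norm_num), rfl, rfl, fun r h h' => by simp [h, h'], ?_⟩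
    rw [if_pos ⟨ht2, ht4, ht1⟩]
  · rw [if_neg ht1] at hr13
    have hr4 : queryProgram.Reaches ⟨73, Function.update (Function.update reg 22
        (BitVec.ofNat w (tab 1 q))) 23 (BitVec.ofNat w (tab 1 p)), mem', out⟩ 1
        ⟨75, Function.update (Function.update reg 22 (BitVec.ofNat w (tab 1 q))) 23
          (BitVec.ofNat w (tab 1 p)), mem', out⟩ := by
      refine reaches_of_execList [] (.jmp 75) rfl rfl rfl rfl
    refine ⟨_, (hr13.trans hr4).mono (by norm_num), rfl, rfl, fun r h h' => by simp [h, h'], ?_⟩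
    rw [if_neg fun h => ht1 h.2.2, List.append_nil]

open Classical in
lemma reaches_of_scan (hL : Layout mem n M b Z tab cand) (hij : i ≤ j) (hj : j < n) (hm : m ≤ n)
    (d : ℕ) {i' p : ℕ} (hi' : i' < 2 ^ w) (hip : i ≤ p) (hpi' : p + d ≤ i') (hpj : p + d ≤ j + 1)
    {c : Config w} (hpc : c.pc = 23) (hmem : c.mem = mem) (hE : Env c.reg M b i j m)
    (h15 : c.reg 15 = BitVec.ofNat w p) (h20 : c.reg 20 = BitVec.ofNat w 0)
    (h26 : c.reg 26 = BitVec.ofNat w i') :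
    ∃ c', queryProgram.Reaches c (d * 22) c' ∧ c'.pc = 23 ∧ c'.mem = mem ∧
      Env c'.reg M b i j m ∧ c'.reg 15 = BitVec.ofNat w (p + d) ∧
      c'.reg 26 = BitVec.ofNat w i' ∧
      c'.out = c.out ++ ((List.range' p d).filter fun p => decide (Accepts tab i j m p)).map
        fun p => BitVec.ofNat w (tab 1 p) := by
  induction d generalizing p c with
  | zero => exact ⟨c, Reaches.refl _ _, hpc, hmem, hE, h15, h26, by simp⟩
  | succ d ih =>
    have hM := hL.size_ge
    have hw := hL.size_lt
    -- One round costs 3 steps to enter the test, at most 16 for the test and 3 to advance: 22 in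
    -- all.
    have hr1 : queryProgram.Reaches c 3 ⟨59, c.reg, c.mem, c.out⟩ := by
      have e1 := hE.r1
      obtain ⟨pc, reg, mem', out⟩ := c
      simp only at hpc hmem e1 h15 h26
      subst hpc hmem
      have hne := (ofNat_inj_of_lt (by omega : p < 2 ^ w) hi').not.2 (by omega)
      have hr1 : queryProgram.Reaches ⟨23, reg, mem', out⟩ 1 ⟨24, reg, mem', out⟩ := by
        refine reaches_of_execList [] (.jeq 15 26 26) rfl rfl rfl ?_
        simp [Config.execList, Instr.exec, h15, h26, hne]
      have hr2 : queryProgram.Reaches ⟨24, reg, mem', out⟩ 1 ⟨25, reg, mem', out⟩ := by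
        refine reaches_of_execList [] (.jlt 1 15 78) rfl rfl rfl ?_
        simp [Config.execList, Instr.exec, h15, e1, -BitVec.toNat_ofNat,
          toNat_ofNat_of_lt (by omega : p < 2 ^ w), toNat_ofNat_of_lt (by omega : j < 2 ^ w),
          (by omega : p ≤ j)]
      have hr3 : queryProgram.Reaches ⟨25, reg, mem', out⟩ 1 ⟨59, reg, mem', out⟩ :=
        reaches_of_execList [] (.jmp 59) rfl rfl rfl rfl
      exact (hr1.trans hr2).trans hr3
    obtain ⟨c2, hr2, h2pc, h2mem, h2reg, h2out⟩ := reaches_of_test (p := p) hL hij hj hm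
      (c := ⟨59, c.reg, c.mem, c.out⟩) rfl hmem hE h15 (by omega)
    have h2E : Env c2.reg M b i j m := hE.congr fun r hr => h2reg r (by omega) (by omega)
    have hr3 : queryProgram.Reaches c2 3
        ⟨23, Function.update c2.reg 15 (BitVec.ofNat w (p + 1)), c2.mem, c2.out⟩ := by
      have e15 := h2reg 15 (by norm_num) (by norm_num)
      have e20 := h2reg 20 (by norm_num) (by norm_num)
      have e21 := h2E.r21
      simp only [h15, h20] at e15 e20
      clear ih hr1 hr2 h2reg h2out h2E
      obtain ⟨pc, reg, mem', out⟩ := c2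
      simp only at h2pc e15 e20 e21
      subst h2pc
      have hne := (ofNat_inj_of_lt (by omega : 0 < 2 ^ w) (by omega : 1 < 2 ^ w)).not.2 (by omega)
      -- Register 20 acts as the return address of the shared test: 0 returns to the scan, 1 to the
      -- candidate loop.
      have hr1 : queryProgram.Reaches ⟨75, reg, mem', out⟩ 1 ⟨76, reg, mem', out⟩ := by
        refine reaches_of_execList [] (.jeq 20 21 41) rfl rfl rfl ?_
        simpa [Config.execList, Instr.exec, e20, e21] using hne
      refine hr1.trans (reaches_of_execList (T := 2) [.op .add 15 15 21] (.jmp 23) rfl rfl rfl ?_)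
      simp [Config.execList, Instr.exec, WOp.eval, e15, e21, BitVec.ofNat_add]
    obtain ⟨c4, hr4, h4pc, h4mem, h4E, h4r, h4r', h4out⟩ := ih (p := p + 1) (by omega) (by omega)
      (by omega)
      (c := ⟨23, Function.update c2.reg 15 (BitVec.ofNat w (p + 1)), c2.mem, c2.out⟩) rfl h2mem
      (h2E.congr fun r hr => Function.update_of_ne (by omega) _ _) (by simp)
      (by simpa using (h2reg 20 (by norm_num) (by norm_num)).trans h20)
      (by simpa using (h2reg 26 (by norm_num) (by norm_num)).trans h26)
    refine ⟨c4, (((hr1.trans hr2).trans hr3).trans hr4).mono (by ring_nf; rfl), h4pc, h4mem, h4E,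
      by rw [h4r]; congr 1; omega, h4r', ?_⟩
    rw [h4out, List.range'_succ, List.filter_cons]
    simp only [h2out]
    split_ifs with h1 h2 h2 <;> simp_all

lemma ofNat_div_ofNat {x y : ℕ} (hx : x < 2 ^ w) (hy : y < 2 ^ w) :
    BitVec.ofNat w x / BitVec.ofNat w y = BitVec.ofNat w (x / y) := by
  rw [BitVec.udiv_def, toNat_ofNat_of_lt hx, toNat_ofNat_of_lt hy]

lemma ofNat_shiftRight_ofNat {x y : ℕ} (hx : x < 2 ^ w) :
    BitVec.ofNat w x >>> y = BitVec.ofNat w (x >>> y) := by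
  apply BitVec.eq_of_toNat_eq
  rw [BitVec.toNat_ushiftRight, toNat_ofNat_of_lt hx, toNat_ofNat_of_lt]
  exact (Nat.shiftRight_le x y).trans_lt hx

lemma reaches_of_init (hL : Layout mem n M b Z tab cand) (hij : i ≤ j) (hj : j < n)
    {c : Config w} (hpc : c.pc = 0) (hmem : c.mem = mem) (h0 : c.reg 0 = BitVec.ofNat w i)
    (h1 : c.reg 1 = BitVec.ofNat w j) :
    ∃ c', queryProgram.Reaches c 23 c' ∧ c'.pc = 23 ∧ c'.mem = mem ∧
      Env c'.reg M b i j (tab 5 (j - i)) ∧ c'.reg 15 = BitVec.ofNat w i ∧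
      c'.reg 20 = BitVec.ofNat w 0 ∧ c'.reg 26 = BitVec.ofNat w ((i / b + 1) * b) ∧
      c'.out = c.out := by
  have hM := hL.size_ge
  have hw := hL.size_lt
  have hn := hL.pos
  have hb := hL.bucket_le
  have hl0 := hL.tab_eq 0 (by norm_num) 0 (by omega)
  have hl1 := hL.tab_eq 0 (by norm_num) 1 (by omega)
  have hl2 := hL.tab_eq 0 (by norm_num) 2 (by omega)
  rw [hL.header_size] at hl0
  rw [hL.header_bucket] at hl1
  rw [hL.header_stride] at hl2
  simp only [zero_mul, zero_add] at hl0 hl1 hl2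
  have hl5 := hL.load 5 (by norm_num) (by omega : j - i < M)
  have hsub := BitVec.ofNat_sub_ofNat_of_le (w := w) j i (by omega) hij
  have hdiv := ofNat_div_ofNat (w := w) (x := i) (y := b) (by omega) (by omega)
  have hadd : ∀ k, BitVec.ofNat w (k * M) + BitVec.ofNat w M = BitVec.ofNat w ((k + 1) * M) :=
    fun k => by rw [← BitVec.ofNat_add]; ring_nf
  have hadd1 : BitVec.ofNat w M + BitVec.ofNat w M = BitVec.ofNat w (2 * M) := by
    rw [← BitVec.ofNat_add]
    ring_nf
  obtain ⟨pc, reg, mem', out⟩ := c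
  simp only at hpc hmem h0 h1
  subst hpc hmem
  -- The final configuration is left open and computed by `rfl` from the code; the simplification
  -- afterwards puts its registers in closed form.
  have hr : queryProgram.Reaches ⟨0, reg, mem', out⟩ 23 _ :=
    reaches_of_execList [.const 22 0, .load 2 22, .const 21 1, .load 3 21, .const 22 2, .load 4 22,
      .op .add 5 2 2, .op .add 6 5 2, .op .add 7 6 2, .op .add 8 7 2, .op .add 9 8 2,
      .op .add 10 9 2, .op .add 11 10 2, .op .add 12 11 2, .op .add 13 12 2,
      .op .sub 22 1 0, .op .add 22 22 8, .load 14 22, .const 20 0, .op .div 26 0 3,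
      .op .add 26 26 21, .op .mul 26 26 3] (.op .add 15 0 20) rfl rfl rfl rfl
  simp [Config.execList, Instr.exec, WOp.eval, h0, h1, hl0, hl1, hl2, hadd1, hadd, hsub, hl5,
    hdiv] at hr
  refine ⟨_, hr, rfl, rfl, ?_, by simp, by simp, by simp [BitVec.ofNat_add, BitVec.ofNat_mul], rfl⟩
  constructor <;> simp [h0, h1]

lemma reaches_of_locate (hL : Layout mem n M b Z tab cand) (hj : j < n) {m p z : ℕ} (hpj : p ≤ j)
    (hz : z = (tab 7 (j - p) + p / tab 6 (j - p)) * (18 * b))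
    {c : Config w} (hpc : c.pc = 26) (hmem : c.mem = mem) (hE : Env c.reg M b i j m)
    (h15 : c.reg 15 = BitVec.ofNat w p) :
    ∃ c', queryProgram.Reaches c 15 c' ∧ c'.pc = 41 ∧ c'.mem = mem ∧ Env c'.reg M b i j m ∧
      c'.reg 16 = BitVec.ofNat w (10 * M + z) ∧
      c'.reg 17 = BitVec.ofNat w (10 * M + (z + 18 * b)) ∧
      c'.reg 18 = BitVec.ofNat w (p % tab 6 (j - p) / b) ∧
      c'.reg 20 = BitVec.ofNat w 1 ∧ c'.out = c.out := by
  have hM := hL.size_ge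
  have hw := hL.size_lt
  have hn := hL.pos
  have hb := hL.bucket_le
  have hl6 := hL.load 6 (by norm_num) (by omega : j - p < M)
  have hl7 := hL.load 7 (by norm_num) (by omega : j - p < M)
  have hsub := BitVec.ofNat_sub_ofNat_of_le (w := w) j p (by omega) hpj
  have hdiv := ofNat_div_ofNat (w := w) (x := p) (y := tab 6 (j - p)) (by omega)
    (hL.width_lt (j - p) (by omega))
  set Q := tab 6 (j - p) with hQ
  -- There is no remainder instruction, so the offset of `p` in its block is computed from the
  -- quotient.
  have hmod : BitVec.ofNat w p - BitVec.ofNat w (p / Q) * BitVec.ofNat w Q =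
      BitVec.ofNat w (p % Q) := by
    have hle := Nat.div_mul_le_self p Q
    rw [← BitVec.ofNat_mul, BitVec.ofNat_sub_ofNat_of_le _ _ (by omega) hle]
    congr 1
    have := Nat.div_add_mod p Q
    rw [mul_comm] at this
    omega
  have hdiv' := ofNat_div_ofNat (w := w) (x := p % Q) (y := b)
    ((Nat.mod_le p Q).trans_lt (by omega)) (by omega)
  have hz' : (BitVec.ofNat w (tab 7 (j - p)) + BitVec.ofNat w (p / Q)) * BitVec.ofNat w (18 * b) +
      BitVec.ofNat w (10 * M) = BitVec.ofNat w (10 * M + z) := by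
    rw [← BitVec.ofNat_add, ← BitVec.ofNat_mul, ← BitVec.ofNat_add, hz, add_comm]
  have hz'' : BitVec.ofNat w (10 * M + z) + BitVec.ofNat w (18 * b) =
      BitVec.ofNat w (10 * M + (z + 18 * b)) := by
    rw [← BitVec.ofNat_add, add_assoc]
  have e1 := hE.r1
  have e3 := hE.r3
  have e4 := hE.r4
  have e9 := hE.r9
  have e10 := hE.r10
  have e13 := hE.r13
  obtain ⟨pc, reg, mem', out⟩ := c
  simp only at hpc hmem e1 e3 e4 e9 e10 e13 h15
  subst hpc hmem
  have hr1 : queryProgram.Reaches ⟨26, reg, mem', out⟩ 1 ⟨27, reg, mem', out⟩ := by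
    refine reaches_of_execList [] (.jlt 1 15 78) rfl rfl rfl ?_
    simp [Config.execList, Instr.exec, h15, e1, -BitVec.toNat_ofNat,
      toNat_ofNat_of_lt (by omega : p < 2 ^ w), toNat_ofNat_of_lt (by omega : j < 2 ^ w),
      (by omega : p ≤ j)]
  have hr2 : queryProgram.Reaches ⟨27, reg, mem', out⟩ 14 _ :=
    reaches_of_execList [.op .sub 22 1 15, .op .add 23 22 9, .load 23 23, .op .add 22 22 10,
      .load 22 22, .op .div 24 15 23, .op .add 22 22 24, .op .mul 16 22 4, .op .add 16 16 13,
      .op .add 17 16 4, .op .mul 24 24 23, .op .sub 24 15 24, .op .div 18 24 3] (.const 20 1)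
      rfl rfl rfl rfl
  simp [Config.execList, Instr.exec, WOp.eval, h15, e1, e3, e4, e9, e10, e13, hsub, hl6, hl7, hdiv,
    hmod, hdiv', hz', hz''] at hr2
  refine ⟨_, hr1.trans hr2, rfl, rfl, hE.congr fun r hr => ?_, by simp, by simp, by simp, by simp,
    rfl⟩
  simp only [Function.update_apply]
  repeat' rw [if_neg (by omega)]

/-- The position obtained from the candidate stored at `z` for a query starting in bucket `t` of
the block. -/
def located (tab : ℕ → ℕ → ℕ) (cand : ℕ → ℕ) (t z : ℕ) : ℕ :=
  tab 8 (cand (z + 1) - tab 9 (cand (z + 2) >>> t))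

/-- The candidate stored at `z` is reported. -/
def Reported (tab : ℕ → ℕ → ℕ) (cand : ℕ → ℕ) (i j m t z : ℕ) : Prop :=
  located tab cand t z ≤ j ∧ tab 1 (located tab cand t z) = cand z ∧
    Accepts tab i j m (located tab cand t z)

/-- The three words of a candidate have admissible values. -/
structure ValidSlot (w M : ℕ) (tab : ℕ → ℕ → ℕ) (cand : ℕ → ℕ) (t z : ℕ) : Prop where
  symbol_lt : cand z < 2 ^ w
  rank_lt : cand (z + 1) < M
  bits_lt : cand (z + 2) < M
  popCount_le : tab 9 (cand (z + 2) >>> t) ≤ cand (z + 1)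

open Classical in
lemma reaches_of_candidate (hL : Layout mem n M b Z tab cand) (hij : i ≤ j) (hj : j < n)
    (hm : m ≤ n) {t z z' : ℕ} (ht : t < 2 ^ w) (hz : z < z') (hz' : z' ≤ Z) (hzZ : z + 3 ≤ Z)
    (hv : ValidSlot w M tab cand t z)
    {c : Config w} (hpc : c.pc = 41) (hmem : c.mem = mem) (hE : Env c.reg M b i j m)
    (h16 : c.reg 16 = BitVec.ofNat w (10 * M + z)) (h17 : c.reg 17 = BitVec.ofNat w (10 * M + z'))
    (h18 : c.reg 18 = BitVec.ofNat w t) (h20 : c.reg 20 = BitVec.ofNat w 1) :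
    ∃ c', queryProgram.Reaches c 34 c' ∧ c'.pc = 41 ∧ c'.mem = mem ∧ Env c'.reg M b i j m ∧
      c'.reg 16 = BitVec.ofNat w (10 * M + (z + 3)) ∧
      (∀ r, r ∈ [17, 18, 20] → c'.reg r = c.reg r) ∧
      c'.out = c.out ++ if Reported tab cand i j m t z then
        [BitVec.ofNat w (tab 1 (located tab cand t z))] else [] := by
  have hM := hL.size_ge
  have hw := hL.size_lt
  obtain ⟨v1, v2, v3, v4⟩ := hv
  have hlc0 := hL.cand_eq z (by omega)
  have hlc1 := hL.cand_eq (z + 1) (by omega)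
  have hlc2 := hL.cand_eq (z + 2) (by omega)
  have hone : ∀ k, BitVec.ofNat w (10 * M + k) + BitVec.ofNat w 1 =
      BitVec.ofNat w (10 * M + (k + 1)) := fun k => by rw [← BitVec.ofNat_add, add_assoc]
  have hsh := ofNat_shiftRight_ofNat (w := w) (x := cand (z + 2)) (y := t) (by omega)
  have hl9 := hL.load 9 (by norm_num) ((Nat.shiftRight_le (cand (z + 2)) t).trans_lt v3)
  have hsub := BitVec.ofNat_sub_ofNat_of_le (w := w) _ _ (by omega) v4
  have hl8 := hL.load 8 (by norm_num)
    (by omega : cand (z + 1) - tab 9 (cand (z + 2) >>> t) < M)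
  change _ = BitVec.ofNat w (located tab cand t z) at hl8
  -- The value `n` means that nothing was found; it exceeds `j`, so the candidate is dropped by the
  -- first comparison.
  have hpn : located tab cand t z ≤ n := hL.bucketSelect_le _
  have hcl : Reported tab cand i j m t z → located tab cand t z ≤ j := fun h => h.1
  set p := located tab cand t z with hp
  have hl1 := hL.load 1 (by norm_num) (by omega : p < M)
  have bj : (BitVec.ofNat w j).toNat = j := toNat_ofNat_of_lt (by omega)
  have bp : (BitVec.ofNat w p).toNat = p := toNat_ofNat_of_lt (by omega)
  have bt : (BitVec.ofNat w t).toNat = t := toNat_ofNat_of_lt ht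
  have hne := (ofNat_inj_of_lt (by omega : 10 * M + z < 2 ^ w)
    (by omega : 10 * M + z' < 2 ^ w)).not.2 (by omega)
  have e1 := hE.r1
  have e2 := hE.r2
  have e11 := hE.r11
  have e12 := hE.r12
  have e21 := hE.r21
  obtain ⟨pc, reg, mem', out⟩ := c
  simp only at hpc hmem e1 e2 e11 e12 e21 h16 h17 h18 h20
  simp only [one_mul] at e2 hl1
  subst hpc hmem
  have hr1 : queryProgram.Reaches ⟨41, reg, mem', out⟩ 1 ⟨42, reg, mem', out⟩ := by
    refine reaches_of_execList [] (.jeq 16 17 78) rfl rfl rfl ?_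
    simp only [Config.execList, Instr.exec, List.nil_append, List.foldl_cons, List.foldl_nil, h16,
      h17, if_neg hne]
  obtain ⟨reg2, hr2, g15, g16, g19, g⟩ : ∃ reg2 : ℕ → MWord w,
      queryProgram.Reaches ⟨42, reg, mem', out⟩ 13 ⟨if j < p then 41 else 55, reg2, mem', out⟩ ∧
      reg2 15 = BitVec.ofNat w p ∧ reg2 16 = BitVec.ofNat w (10 * M + (z + 3)) ∧
      reg2 19 = BitVec.ofNat w (cand z) ∧
      ∀ r, r ∉ [15, 16, 19, 22, 23] → reg2 r = reg r := by
    have hr : queryProgram.Reaches ⟨42, reg, mem', out⟩ 13 _ :=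
      reaches_of_execList [.load 19 16, .op .add 16 16 21, .load 22 16, .op .add 16 16 21,
        .load 23 16, .op .add 16 16 21, .op .shr 23 23 18, .op .add 23 23 12, .load 23 23,
        .op .sub 22 22 23, .op .add 22 22 11, .load 15 22] (.jlt 1 15 41) rfl rfl rfl rfl
    simp only [Config.execList, List.cons_append, List.nil_append, List.foldl_cons, List.foldl_nil,
      Instr.exec, WOp.eval] at hr
    simp [-BitVec.toNat_ofNat, -BitVec.ofNat_eq_ofNat,
      h16, h18, e1, e11, e12, e21, hone, hlc0, hlc1, hlc2, bt, hsh, hl9, hsub, hl8, bj, bp] at hr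
    refine ⟨_, hr, by simp, by simp, by simp, fun r hr => ?_⟩
    simp only [List.mem_cons, List.not_mem_nil, or_false, not_or] at hr
    simp only [Function.update_apply]
    repeat' rw [if_neg (by omega)]
  have hE2 : Env reg2 M b i j m :=
    hE.congr fun r hr => g r (by simp only [List.mem_cons, List.not_mem_nil, or_false]; omega)
  have hr12 := hr1.trans hr2
  by_cases hpj : p ≤ j
  swap
  · rw [if_pos (not_le.1 hpj)] at hr12
    refine ⟨_, hr12.mono (by norm_num), rfl, rfl, hE2, g16, fun r hr => g r ?_, ?_⟩
    · simp only [List.mem_cons, List.not_mem_nil, or_false] at hr ⊢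
      omega
    · rw [if_neg fun h => hpj (hcl h), List.append_nil]
  rw [if_neg (not_lt.2 hpj)] at hr12
  have hr3 : queryProgram.Reaches ⟨55, reg2, mem', out⟩ 3 ⟨if tab 1 p = cand z then 59 else 58,
      Function.update reg2 22 (BitVec.ofNat w (tab 1 p)), mem', out⟩ := by
    refine reaches_of_execList [.op .add 22 15 2, .load 22 22] (.jeq 22 19 59) rfl rfl rfl ?_
    have := ofNat_inj_of_lt (hL.symbol_lt p) v1
    have e2' := hE2.r2
    simp only [one_mul] at e2'
    simp [Config.execList, Instr.exec, WOp.eval, g15, g19, e2', hl1, this]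
  have hr13 := hr12.trans hr3
  set reg3 := Function.update reg2 22 (BitVec.ofNat w (tab 1 p)) with hreg3
  have g3 : ∀ r, r ≠ 22 → reg3 r = reg2 r := fun r hr => Function.update_of_ne hr _ _
  have hE3 : Env reg3 M b i j m := hE2.congr fun r hr => g3 r (by omega)
  by_cases hc : tab 1 p = cand z
  swap
  · rw [if_neg hc] at hr13
    have hr4 : queryProgram.Reaches ⟨58, reg3, mem', out⟩ 1 ⟨41, reg3, mem', out⟩ :=
      reaches_of_execList [] (.jmp 41) rfl rfl rfl rfl
    refine ⟨_, (hr13.trans hr4).mono (by norm_num), rfl, rfl, hE3, ?_, fun r hr => ?_, ?_⟩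
    · exact (g3 16 (by norm_num)).trans g16
    · simp only [List.mem_cons, List.not_mem_nil, or_false] at hr
      refine (g3 r (by omega)).trans (g r ?_)
      simp only [List.mem_cons, List.not_mem_nil, or_false]
      omega
    · rw [if_neg fun h => hc h.2.1, List.append_nil]
  rw [if_pos hc] at hr13
  obtain ⟨c4, hr4, h4pc, h4mem, h4reg, h4out⟩ := reaches_of_test (p := p) hL hij hj hm
    (c := ⟨59, reg3, mem', out⟩) rfl rfl hE3 ((g3 15 (by norm_num)).trans g15) hpj
  have h4E : Env c4.reg M b i j m := hE3.congr fun r hr => h4reg r (by omega) (by omega)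
  have g4 : ∀ r, r ∉ [15, 16, 19, 22, 23] → c4.reg r = reg r := fun r hr => by
    have hr' := hr
    simp only [List.mem_cons, List.not_mem_nil, or_false] at hr'
    exact (h4reg r (by omega) (by omega)).trans ((g3 r (by omega)).trans (g r hr))
  have h416 : c4.reg 16 = BitVec.ofNat w (10 * M + (z + 3)) :=
    (h4reg 16 (by norm_num) (by norm_num)).trans ((g3 16 (by norm_num)).trans g16)
  have hr5 : queryProgram.Reaches c4 1 ⟨41, c4.reg, c4.mem, c4.out⟩ := by
    have e20 := (g4 20 (by simp)).trans h20
    have e21' := h4E.r21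
    clear hr4 h4reg h4out h4E g4 h416
    obtain ⟨pc, reg', mem'', out'⟩ := c4
    simp only at h4pc e20 e21'
    subst h4pc
    refine reaches_of_execList [] (.jeq 20 21 41) rfl rfl rfl ?_
    simp [Config.execList, Instr.exec, e20, e21']
  -- The bound of 34 steps is 1 + 13 + 3 + 16 + 1: loop head, location, symbol check, test, return.
  refine ⟨_, ((hr13.trans hr4).trans hr5).mono (by norm_num), rfl, h4mem, h4E, h416,
    fun r hr => g4 r ?_, ?_⟩
  · simp only [List.mem_cons, List.not_mem_nil, or_false] at hr ⊢
    omega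
  · rw [h4out]
    have : Reported tab cand i j m t z ↔ Accepts tab i j m p :=
      ⟨fun h => h.2.2, fun h => ⟨hpj, hc, h⟩⟩
    simp only [this]

open Classical in
lemma reaches_of_candidates (hL : Layout mem n M b Z tab cand) (hij : i ≤ j) (hj : j < n)
    (hm : m ≤ n) {t : ℕ} (ht : t < 2 ^ w) (d : ℕ) {z : ℕ} (hzZ : z + 3 * d ≤ Z)
    (hv : ∀ s < d, ValidSlot w M tab cand t (z + 3 * s))
    {c : Config w} (hpc : c.pc = 41) (hmem : c.mem = mem) (hE : Env c.reg M b i j m)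
    (h16 : c.reg 16 = BitVec.ofNat w (10 * M + z))
    (h17 : c.reg 17 = BitVec.ofNat w (10 * M + (z + 3 * d)))
    (h18 : c.reg 18 = BitVec.ofNat w t) (h20 : c.reg 20 = BitVec.ofNat w 1) :
    ∃ c', queryProgram.Reaches c (d * 34 + 1) c' ∧ c'.pc = 78 ∧ c'.mem = mem ∧
      c'.out = c.out ++
        ((List.range d).filter fun s => decide (Reported tab cand i j m t (z + 3 * s))).map
          fun s => BitVec.ofNat w (tab 1 (located tab cand t (z + 3 * s))) := by
  induction d generalizing z c with
  | zero =>
    obtain ⟨pc, reg, mem', out⟩ := c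
    simp only at hpc hmem h16 h17
    subst hpc hmem
    refine ⟨⟨78, reg, mem', out⟩, ?_, rfl, rfl, by simp⟩
    refine reaches_of_execList [] (.jeq 16 17 78) rfl rfl rfl ?_
    simp [Config.execList, Instr.exec, h16, h17]
  | succ d ih =>
    obtain ⟨c1, hr1, h1pc, h1mem, h1E, h116, h1reg, h1out⟩ := reaches_of_candidate hL hij hj hm ht
      (z := z) (by omega) hzZ (by omega) (by simpa using hv 0 (by omega)) hpc hmem hE h16 h17 h18
      h20
    obtain ⟨c2, hr2, h2pc, h2mem, h2out⟩ := ih (z := z + 3) (by omega)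
      (fun s hs => by
        have := hv (s + 1) (by omega)
        rwa [mul_add, mul_one, add_comm (3 * s), ← add_assoc] at this)
      h1pc h1mem h1E h116
      (by rw [h1reg 17 (by simp), h17]; congr 1; omega)
      (by rw [h1reg 18 (by simp), h18]) (by rw [h1reg 20 (by simp), h20])
    refine ⟨c2, (hr1.trans hr2).mono (by ring_nf; rfl), h2pc, h2mem, ?_⟩
    rw [h2out, h1out, List.append_assoc]
    congr 1
    have hsh : ∀ s, z + 3 + 3 * s = z + 3 * (s + 1) := fun s => by ring
    simp only [List.range_succ_eq_map, List.filter_cons, List.filter_map, hsh, mul_zero, add_zero]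
    split_ifs with h1 h2 h2 <;> simp_all [Function.comp_def]

/-! ### Complete runs of a query -/

/-- The first bucket boundary to the right of `i`. -/
def nextBoundary (b i : ℕ) : ℕ := (i / b + 1) * b

lemma lt_nextBoundary {b i : ℕ} (hb : 0 < b) : i < nextBoundary b i := by
  unfold nextBoundary
  rw [← Nat.div_lt_iff_lt_mul hb]
  omega

lemma nextBoundary_le (b i : ℕ) : nextBoundary b i ≤ i + b := by
  unfold nextBoundary
  rw [add_mul, one_mul]
  exact Nat.add_le_add_right (Nat.div_mul_le_self i b) b

open Classical in
/-- The output of a query while it scans the first bucket. -/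
noncomputable def scanOutput (w : ℕ) (tab : ℕ → ℕ → ℕ) (b i j m : ℕ) : List (MWord w) :=
  ((List.range' i (min (nextBoundary b i) (j + 1) - i)).filter
    fun p => decide (Accepts tab i j m p)).map fun p => BitVec.ofNat w (tab 1 p)

open Classical in
/-- The output of a query while it goes through the `d` candidates stored from `z` on. -/
noncomputable def candidateOutput (w : ℕ) (tab : ℕ → ℕ → ℕ) (cand : ℕ → ℕ)
    (d i j m t z : ℕ) : List (MWord w) :=
  ((List.range d).filter fun s => decide (Reported tab cand i j m t (z + 3 * s))).map
    fun s => BitVec.ofNat w (tab 1 (located tab cand t (z + 3 * s)))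

/-- Behaviour on ranges that end in the bucket in which they start. -/
lemma reaches_of_short_query (hL : Layout mem n M b Z tab cand) (hij : i ≤ j) (hj : j < n)
    {c : Config w} (hpc : c.pc = 0) (hmem : c.mem = mem) (h0 : c.reg 0 = BitVec.ofNat w i)
    (h1 : c.reg 1 = BitVec.ofNat w j) (hshort : j < nextBoundary b i) :
    ∃ c', queryProgram.Reaches c (b * 22 + 25) c' ∧ c'.pc = 78 ∧ c'.mem = mem ∧
      c'.out = c.out ++ scanOutput w tab b i j (tab 5 (j - i)) := by
  have hM := hL.size_ge
  have hw := hL.size_lt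
  have hb := hL.bucket_le
  have hle := nextBoundary_le b i
  obtain ⟨c1, hr1, h1pc, h1mem, h1E, h115, h120, h126, h1out⟩ :=
    reaches_of_init hL hij hj hpc hmem h0 h1
  obtain ⟨c2, hr2, h2pc, h2mem, h2E, h215, h226, h2out⟩ :=
    reaches_of_scan hL hij hj (hL.freq_le (j - i) (by omega)) (j + 1 - i) (i' := nextBoundary b i)
      (p := i) (by omega) le_rfl (by omega) (by omega) h1pc h1mem h1E h115 h120 h126
  have e1 := h2E.r1
  obtain ⟨pc, reg, mem', out⟩ := c2
  simp only at h2pc h2mem e1 h215 h226 h2out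
  subst h2pc h2mem
  rw [show i + (j + 1 - i) = j + 1 by omega] at h215
  have bj : (BitVec.ofNat w j).toNat = j := toNat_ofNat_of_lt (by omega)
  have bj1 : (BitVec.ofNat w (j + 1)).toNat = j + 1 := toNat_ofNat_of_lt (by omega)
  have hinj := ofNat_inj_of_lt (by omega : j + 1 < 2 ^ w) (by omega : nextBoundary b i < 2 ^ w)
  have hr3 : queryProgram.Reaches ⟨23, reg, mem', out⟩ 1
      ⟨if j + 1 = nextBoundary b i then 26 else 24, reg, mem', out⟩ := by
    refine reaches_of_execList [] (.jeq 15 26 26) rfl rfl rfl ?_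
    simp [Config.execList, Instr.exec, h215, h226, hinj]
  -- The scan stops at `j + 1`, which may itself be the bucket boundary; both exits begin with the
  -- same comparison, which ends the run.
  have hr4 : queryProgram.Reaches ⟨if j + 1 = nextBoundary b i then 26 else 24, reg, mem', out⟩ 1
      ⟨78, reg, mem', out⟩ := by
    split_ifs
    · refine reaches_of_execList [] (.jlt 1 15 78) rfl rfl rfl ?_
      simp [Config.execList, Instr.exec, h215, e1, bj, bj1, -BitVec.toNat_ofNat]
    · refine reaches_of_execList [] (.jlt 1 15 78) rfl rfl rfl ?_
      simp [Config.execList, Instr.exec, h215, e1, bj, bj1, -BitVec.toNat_ofNat]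
  refine ⟨_, (((hr1.trans hr2).trans hr3).trans hr4).mono (by omega), rfl, rfl, ?_⟩
  rw [scanOutput, min_eq_right (by omega)]
  exact h2out.trans (by rw [h1out])

/-- Behaviour on ranges that extend beyond the bucket in which they start. -/
lemma reaches_of_long_query (hL : Layout mem n M b Z tab cand) (hij : i ≤ j) (hj : j < n)
    {c : Config w} (hpc : c.pc = 0) (hmem : c.mem = mem) (h0 : c.reg 0 = BitVec.ofNat w i)
    (h1 : c.reg 1 = BitVec.ofNat w j) {p Q z : ℕ} (hp : p = nextBoundary b i) (hlong : p ≤ j)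
    (hQ : Q = tab 6 (j - p)) (hz : z = (tab 7 (j - p) + p / Q) * (18 * b)) (hzZ : z + 18 * b ≤ Z)
    (hv : ∀ s < 6 * b, ValidSlot w M tab cand (p % Q / b) (z + 3 * s)) :
    ∃ c', queryProgram.Reaches c (b * 226 + 41) c' ∧ c'.pc = 78 ∧ c'.mem = mem ∧
      c'.out = c.out ++ (scanOutput w tab b i j (tab 5 (j - i)) ++
        candidateOutput w tab cand (6 * b) i j (tab 5 (j - i)) (p % Q / b) z) := by
  have hM := hL.size_ge
  have hw := hL.size_lt
  have hle := nextBoundary_le b i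
  have hlt := lt_nextBoundary (i := i) hL.bucket_pos
  have hm := hL.freq_le (j - i) (by omega)
  obtain ⟨c1, hr1, h1pc, h1mem, h1E, h115, h120, h126, h1out⟩ :=
    reaches_of_init hL hij hj hpc hmem h0 h1
  obtain ⟨c2, hr2, h2pc, h2mem, h2E, h215, h226, h2out⟩ :=
    reaches_of_scan hL hij hj hm (p - i) (i' := p)
      (p := i) (by omega) le_rfl (by omega) (by omega) h1pc h1mem h1E h115 h120 (hp ▸ h126)
  rw [show i + (p - i) = p by omega] at h215
  have hr3 : queryProgram.Reaches c2 1 ⟨26, c2.reg, c2.mem, c2.out⟩ := by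
    clear hr2 h2out h2E
    obtain ⟨pc, reg, mem', out⟩ := c2
    simp only at h2pc h2mem h215 h226
    subst h2pc h2mem
    refine reaches_of_execList [] (.jeq 15 26 26) rfl rfl rfl ?_
    simp [Config.execList, Instr.exec, h215, h226]
  obtain ⟨c4, hr4, h4pc, h4mem, h4E, h416, h417, h418, h420, h4out⟩ :=
    reaches_of_locate hL hj hlong (hQ ▸ hz) (c := ⟨26, c2.reg, c2.mem, c2.out⟩) rfl h2mem h2E h215
  rw [← hQ] at h418
  have ht : p % Q / b < 2 ^ w :=
    ((Nat.div_le_self _ _).trans (Nat.mod_le _ _)).trans_lt (by omega)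
  obtain ⟨c5, hr5, h5pc, h5mem, h5out⟩ := reaches_of_candidates hL hij hj hm ht (6 * b)
    (z := z) (by omega) hv h4pc h4mem h4E h416 (by rw [h417]; congr 2; ring) h418 h420
  refine ⟨c5, ((((hr1.trans hr2).trans hr3).trans hr4).trans hr5).mono (by omega), h5pc, h5mem, ?_⟩
  rw [h5out, h4out]
  simp only [h2out, h1out, List.append_assoc]
  rw [scanOutput, min_eq_left (by omega), ← hp, candidateOutput]

end Query

/-! ### The data structure -/

/-- The number of bits of a bitmap. -/
def bitmapBits (n : ℕ) : ℕ := Nat.log 2 n + 1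

/-- The number of buckets in a block of level `k`. -/
def blockBuckets (n k : ℕ) : ℕ := min (2 ^ k) (bitmapBits n)

/-- The number of blocks (of buckets of size `b`) on the levels below `k`. -/
def blocksBelow (n b k : ℕ) : ℕ := ∑ l ∈ Finset.range k, (n / (blockBuckets n l * b) + 1)

/-- The number of levels. -/
def levelCount (n b : ℕ) : ℕ := Nat.log 2 (n / b + 1) + 1

/-- The level responsible for ranges of length `x + 1`. -/
def rangeLevel (b x : ℕ) : ℕ := Nat.log 2 ((x + 1) / b + 1)

/-- The level of the block with index `d`. -/
def blockLevel (n b d : ℕ) : ℕ := Nat.findGreatest (fun k => blocksBelow n b k ≤ d) (levelCount n b)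

lemma blockBuckets_pos (n k : ℕ) : 0 < blockBuckets n k :=
  lt_min (by positivity) (Nat.succ_pos _)

lemma blocksBelow_succ (n b k : ℕ) :
    blocksBelow n b (k + 1) = blocksBelow n b k + (n / (blockBuckets n k * b) + 1) :=
  Finset.sum_range_succ _ _

lemma blocksBelow_mono (n b : ℕ) : Monotone (blocksBelow n b) :=
  monotone_nat_of_le_succ fun k => by rw [blocksBelow_succ]; exact Nat.le_add_right _ _

/-- Blocks are numbered level by level, so each level owns an interval of indices. -/
lemma blockLevel_eq {n b d k : ℕ} (hk : k ≤ levelCount n b) (h : blocksBelow n b k ≤ d)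
    (h' : d < blocksBelow n b (k + 1)) : blockLevel n b d = k := by
  unfold blockLevel
  rw [Nat.findGreatest_eq_iff]
  refine ⟨hk, fun _ => h, fun l hl _ hle => ?_⟩
  have := blocksBelow_mono n b (Nat.succ_le_of_lt hl)
  simp only [Nat.succ_eq_add_one] at this
  omega

/-- The cap on the block size costs about `n / bitmapBits n` per level; comparing the number of
levels with the cap makes the total linear. -/
lemma levelCount_le_bitmapBits (n b : ℕ) : levelCount n b ≤ 2 * bitmapBits n := by
  have h1 : Nat.log 2 (n / b + 1) ≤ Nat.log 2 (2 * n + 1) :=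
    Nat.log_mono_right (by have := Nat.div_le_self n b; omega)
  have h2 : Nat.log 2 (2 * n + 1) ≤ Nat.log 2 n + 1 := by
    rcases Nat.eq_zero_or_pos n with rfl | hn
    · simp
    · refine Nat.lt_succ_iff.1 ((Nat.log_lt_iff_lt_pow (by norm_num) (by omega)).2 ?_)
      have := Nat.lt_pow_succ_log_self (b := 2) (by norm_num) n
      rw [pow_succ]
      simp only [Nat.succ_eq_add_one] at this ⊢
      omega
  unfold levelCount bitmapBits
  omega

/-- The blocks take linear space. -/
lemma blocksBelow_mul_le {n b : ℕ} (hb : b ≤ n) :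
    blocksBelow n b (levelCount n b) * b ≤ 6 * n := by
  -- The minimum in the block size is replaced by a sum over both alternatives. Over all levels the
  -- three summands contribute at most `2 * n` (geometric series), `2 * n` (number of levels against
  -- the cap) and `n + b ≤ 2 * n`.
  have hterm : ∀ k, (n / (blockBuckets n k * b) + 1) * b ≤
      n / 2 ^ k + n / bitmapBits n + b := by
    intro k
    rw [add_mul, one_mul, ← Nat.div_div_eq_div_mul]
    refine Nat.add_le_add_right ((Nat.div_mul_le_self _ _).trans ?_) b
    rcases min_choice (2 ^ k) (bitmapBits n) with h | h <;> rw [blockBuckets, h]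
    · exact Nat.le_add_right _ _
    · exact Nat.le_add_left _ _
  have hsum : blocksBelow n b (levelCount n b) * b ≤
      ∑ k ∈ Finset.range (levelCount n b), (n / 2 ^ k + n / bitmapBits n + b) := by
    rw [blocksBelow, Finset.sum_mul]
    exact Finset.sum_le_sum fun k _ => hterm k
  rw [Finset.sum_add_distrib, Finset.sum_add_distrib, Finset.sum_const, Finset.sum_const,
    Finset.card_range, smul_eq_mul, smul_eq_mul] at hsum
  have h1 := Nat.geom_sum_le (le_refl 2) n (levelCount n b)
  have h2 : levelCount n b * (n / bitmapBits n) ≤ 2 * n := by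
    refine (Nat.mul_le_mul_right _ (levelCount_le_bitmapBits n b)).trans ?_
    rw [mul_assoc]
    exact Nat.mul_le_mul_left 2 (Nat.mul_div_le n (bitmapBits n))
  have h3 : levelCount n b * b ≤ n + b := by
    have : levelCount n b ≤ n / b + 1 := Nat.log_lt_self 2 (Nat.succ_ne_zero _)
    refine (Nat.mul_le_mul_right b this).trans ?_
    rw [add_mul, one_mul]
    exact Nat.add_le_add_right (Nat.div_mul_le_self n b) b
  simp only [Nat.add_one_sub_one, Nat.div_one] at h1
  omega

/-- The tables. Here `T x + 1` is the least number of occurrences of a majority in a range of length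
`x + 1`. -/
noncomputable def table (n b : ℕ) (S T : ℕ → ℕ) : ℕ → ℕ → ℕ
  | 0, 0 => 2 * n + 2
  | 0, 1 => b
  | 0, _ => 18 * b
  | 1, y => S y
  | 2, y => prevSucc S y
  | 3, y => posRank n S y
  | 4, y => classSelect n (· < n) S y
  | 5, y => T y
  | 6, y => blockBuckets n (rangeLevel b y) * b
  | 7, y => blocksBelow n b (rangeLevel b y)
  | 8, y => classSelect n (BucketFirst n b S) S y
  | _, y => popCount (bitmapBits n) y

/-- The candidates of block `e` of level `k`. -/
noncomputable def blockCandidates (n b : ℕ) (S : ℕ → ℕ) (k e : ℕ) : List ℕ :=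
  (candidates n b S (e * blockBuckets n k * b) k).toList

lemma nodup_blockCandidates (n b : ℕ) (S : ℕ → ℕ) (k e : ℕ) :
    (blockCandidates n b S k e).Nodup := Finset.nodup_toList _

/-- The three words stored for candidate number `s` of block `e` of level `k`. -/
noncomputable def slotWord (n b : ℕ) (S : ℕ → ℕ) (k e s f : ℕ) : ℕ :=
  match (blockCandidates n b S k e)[s]?, f with
  | none, 1 => n + 1
  | none, _ => 0
  | some a, 0 => a
  | some a, 1 =>
    classRank n (BucketFirst n b S) S a ((e * blockBuckets n k + blockBuckets n k) * b)
  | some a, _ =>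
    bitmap (blockBuckets n k) fun u => BucketHas n b S a (e * blockBuckets n k + u)

/-- The array of candidates. -/
noncomputable def candidateArray (n b : ℕ) (S : ℕ → ℕ) (z : ℕ) : ℕ :=
  slotWord n b S (blockLevel n b (z / (18 * b)))
    (z / (18 * b) - blocksBelow n b (blockLevel n b (z / (18 * b)))) (z % (18 * b) / 3) (z % 3)

/-- The address is a mixed-radix numeral with digits block, slot and field; `18 * b` is `6 * b`
slots of three words. -/
lemma candidateArray_eq {n b : ℕ} (S : ℕ → ℕ) {k e s f : ℕ} (hk : k < levelCount n b)
    (he : e ≤ n / (blockBuckets n k * b)) (hs : s < 6 * b) (hf : f < 3) :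
    candidateArray n b S ((blocksBelow n b k + e) * (18 * b) + 3 * s + f) =
      slotWord n b S k e s f := by
  have h1 : ((blocksBelow n b k + e) * (18 * b) + 3 * s + f) / (18 * b) = blocksBelow n b k + e := by
    rw [add_assoc, mul_comm, Nat.mul_add_div (by omega), Nat.div_eq_of_lt (by omega), add_zero]
  have h2 : ((blocksBelow n b k + e) * (18 * b) + 3 * s + f) % (18 * b) = 3 * s + f := by
    rw [add_assoc, mul_comm, Nat.mul_add_mod, Nat.mod_eq_of_lt (by omega)]
  have h3 : ((blocksBelow n b k + e) * (18 * b) + 3 * s + f) % 3 = f := by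
    have : (blocksBelow n b k + e) * (18 * b) + 3 * s + f =
      3 * ((blocksBelow n b k + e) * (6 * b) + s) + f := by ring
    rw [this, Nat.mul_add_mod, Nat.mod_eq_of_lt hf]
  have h4 : blockLevel n b (blocksBelow n b k + e) = k :=
    blockLevel_eq hk.le (Nat.le_add_right _ _) (by rw [blocksBelow_succ]; omega)
  rw [candidateArray, h1, h2, h3, h4, Nat.add_sub_cancel_left]
  congr 1
  omega

lemma rangeLevel_lt {n b x : ℕ} (hx : x < n) : rangeLevel b x < levelCount n b :=
  Nat.lt_succ_iff.2 (Nat.log_mono_right (Nat.succ_le_succ (Nat.div_le_div_right hx)))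

lemma blockWidth_le {n b x : ℕ} (hx : x < n) (hb : b ≤ n) :
    blockBuckets n (rangeLevel b x) * b ≤ 2 * n := by
  have h1 : blockBuckets n (rangeLevel b x) ≤ (x + 1) / b + 1 :=
    (min_le_left _ _).trans (Nat.pow_log_le_self 2 (Nat.succ_ne_zero _))
  refine (Nat.mul_le_mul_right b h1).trans ?_
  have := Nat.div_mul_le_self (x + 1) b
  rw [add_mul]
  omega

/-- The contents of memory cell `a`. -/
noncomputable def cell (n b : ℕ) (S T : ℕ → ℕ) (a : ℕ) : ℕ :=
  if a < 10 * (2 * n + 2) then table n b S T (a / (2 * n + 2)) (a % (2 * n + 2))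
  else candidateArray n b S (a - 10 * (2 * n + 2))

/-- The number of cells of the array of candidates. -/
def candidateCells (n b : ℕ) : ℕ := blocksBelow n b (levelCount n b) * (18 * b)

/-- The data structure as a list of words. -/
noncomputable def dataWords (w n b : ℕ) (S T : ℕ → ℕ) : List (MWord w) :=
  (List.range (10 * (2 * n + 2) + candidateCells n b)).map fun a => BitVec.ofNat w (cell n b S T a)

/-- The candidates take at most `18 * 6 * n` cells and the tables `20 * n + 20 ≤ 40 * n`. -/
lemma size_le {n b : ℕ} (hn : 0 < n) (hb : b ≤ n) :
    10 * (2 * n + 2) + candidateCells n b ≤ 148 * n := by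
  have := blocksBelow_mul_le hb
  have h : candidateCells n b = 18 * (blocksBelow n b (levelCount n b) * b) := by
    unfold candidateCells
    ring
  omega

lemma layout_of_stores {w n b : ℕ} {S T : ℕ → ℕ} {c : Config w}
    (hc : c.Stores (dataWords w n b S T)) (hb : 0 < b) (hbn : b ≤ n) (hw : 148 * n < 2 ^ w)
    (hS : ∀ y, S y < 2 ^ w) (hT : ∀ x < n, T x ≤ n) :
    Layout c.mem n (2 * n + 2) b (candidateCells n b) (table n b S T) (candidateArray n b S) := by
  have hsize := size_le (hb.trans_le hbn) hbn
  have hcell : ∀ a < 10 * (2 * n + 2) + candidateCells n b,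
      c.mem (BitVec.ofNat w a) = BitVec.ofNat w (cell n b S T a) := fun a ha => by
    rw [hc a (by simpa [dataWords] using ha)]
    simp [dataWords]
  refine
    { tab_eq := fun f hf y hy => ?_
      cand_eq := fun z hz => ?_
      size_lt := by omega
      size_ge := le_rfl
      pos := hb.trans_le hbn
      bucket_pos := hb
      bucket_le := hbn
      header_size := rfl
      header_bucket := rfl
      header_stride := rfl
      symbol_lt := hS
      prev_le := fun y hy => (prevSucc_le_self S y).trans hy.le
      rank_le := fun y _ => classRank_le (fun _ h => h) _ _
      select_le := fun y => classSelect_le (fun _ h => h) _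
      freq_le := hT
      width_pos := fun y _ => Nat.mul_pos (blockBuckets_pos n _) hb
      width_lt := fun y hy => (blockWidth_le hy hbn).trans_lt (by omega)
      bucketSelect_le := fun y => classSelect_le (fun _ h => h.1) _ }
  · have hlt : f * (2 * n + 2) + y < 10 * (2 * n + 2) := by
      have := Nat.mul_le_mul_right (2 * n + 2) (Nat.succ_le_of_lt hf)
      rw [Nat.succ_mul] at this
      omega
    have h1 : (f * (2 * n + 2) + y) / (2 * n + 2) = f := by
      rw [mul_comm, Nat.mul_add_div (by omega), Nat.div_eq_of_lt hy, add_zero]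
    have h2 : (f * (2 * n + 2) + y) % (2 * n + 2) = y := by
      rw [mul_comm, Nat.mul_add_mod, Nat.mod_eq_of_lt hy]
    rw [hcell _ (by omega), cell, if_pos hlt, h1, h2]
  · rw [hcell _ (by omega), cell, if_neg (by omega), Nat.add_sub_cancel_left]

/-! ### Correctness of the query -/

section Correct

variable {w n b : ℕ} {S T : ℕ → ℕ} {i j m : ℕ}

lemma accepts_iff {p : ℕ} (hip : i ≤ p) (hpj : p ≤ j) (hj : j < n) :
    Accepts (table n b S T) i j m p ↔
      (∀ q, i ≤ q → q < p → S q ≠ S p) ∧ m < cnt (fun q => S q = S p) i (j + 1) :=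
  leftmost_and_frequent_iff hip hpj hj

/-- A symbol has at most one accepted position. -/
lemma Accepts.eq {p q : ℕ} (hip : i ≤ p) (hpj : p ≤ j) (hiq : i ≤ q) (hqj : q ≤ j) (hj : j < n)
    (hp : Accepts (table n b S T) i j m p) (hq : Accepts (table n b S T) i j m q)
    (h : S p = S q) : p = q := by
  rw [accepts_iff hip hpj hj] at hp
  rw [accepts_iff hiq hqj hj] at hq
  rcases lt_trichotomy p q with hlt | heq | hlt
  · exact absurd h (hq.1 p hip hlt)
  · exact heq
  · exact absurd h.symm (hp.1 q hiq hlt)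

lemma exists_accepts {a : ℕ} (hj : j < n) (ha : m < cnt (fun q => S q = a) i (j + 1)) :
    ∃ p, i ≤ p ∧ p ≤ j ∧ S p = a ∧ Accepts (table n b S T) i j m p := by
  obtain ⟨p, h1, h2, h3, h4⟩ := exists_cnt_eq ((Nat.zero_le m).trans_lt ha)
  refine ⟨p, h1, by omega, h3, (accepts_iff h1 (by omega) hj).2 ⟨fun q hq hqp => ?_, ?_⟩⟩
  · rw [h3]
    exact cnt_eq_zero.1 h4 q hq hqp
  · rwa [h3]

/-- No rank exceeds `n`, so the rank `n + 1` stored in an empty slot leads to the position `n`,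
beyond every range. -/
lemma classSelect_eq_of_lt {F : ℕ → Prop} (hF : ∀ q, F q → q < n) {y : ℕ} (hy : n < y) :
    classSelect n F S y = n := by
  by_contra hne
  have hlt := lt_of_le_of_ne (classSelect_le hF y) hne
  have h1 := (classSelect_spec rfl hlt).2
  have h2 := classRank_le hF (S := S) (S (classSelect n F S y)) (classSelect n F S y)
  omega

/-- Between bucket `t` and the end of the block the rank of `a` grows by one for each bucket
containing `a`, because only first occurrences in buckets are ranked. -/
lemma popCount_slot (a e t k : ℕ) (hb : 0 < b) (ht : t < blockBuckets n k) :
    classRank n (BucketFirst n b S) S a ((e * blockBuckets n k + t) * b) +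
      popCount (bitmapBits n) (bitmap (blockBuckets n k)
        (fun u => BucketHas n b S a (e * blockBuckets n k + u)) >>> t) =
    classRank n (BucketFirst n b S) S a ((e * blockBuckets n k + blockBuckets n k) * b) := by
  rw [popCount_shift_bitmap (m := blockBuckets n k) (min_le_right _ _), ← cnt_bucketFirst hb]
  exact classRank_add (Nat.mul_le_mul_right b (by omega))

section Slots

variable {k e t z : ℕ}

lemma slotWord_none {s : ℕ} (h : (blockCandidates n b S k e)[s]? = none) :
    slotWord n b S k e s 0 = 0 ∧ slotWord n b S k e s 1 = n + 1 ∧ slotWord n b S k e s 2 = 0 := by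
  simp [slotWord, h]

lemma slotWord_some {s a : ℕ} (h : (blockCandidates n b S k e)[s]? = some a) :
    slotWord n b S k e s 0 = a ∧
    slotWord n b S k e s 1 =
      classRank n (BucketFirst n b S) S a ((e * blockBuckets n k + blockBuckets n k) * b) ∧
    slotWord n b S k e s 2 =
      bitmap (blockBuckets n k) fun u => BucketHas n b S a (e * blockBuckets n k + u) := by
  simp [slotWord, h]

lemma candidateArray_slot {s : ℕ} (hk : k < levelCount n b)
    (he : e ≤ n / (blockBuckets n k * b)) (hz : z = (blocksBelow n b k + e) * (18 * b))
    (hs : s < 6 * b) :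
    candidateArray n b S (z + 3 * s) = slotWord n b S k e s 0 ∧
    candidateArray n b S (z + 3 * s + 1) = slotWord n b S k e s 1 ∧
    candidateArray n b S (z + 3 * s + 2) = slotWord n b S k e s 2 := by
  subst hz
  exact ⟨candidateArray_eq S (f := 0) hk he hs (by norm_num),
    candidateArray_eq S hk he hs (by norm_num), candidateArray_eq S hk he hs (by norm_num)⟩

lemma located_none {s : ℕ} (hk : k < levelCount n b) (he : e ≤ n / (blockBuckets n k * b))
    (hz : z = (blocksBelow n b k + e) * (18 * b)) (hs : s < 6 * b)
    (h : (blockCandidates n b S k e)[s]? = none) :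
    located (table n b S T) (candidateArray n b S) t (z + 3 * s) = n := by
  obtain ⟨-, h1, h2⟩ := candidateArray_slot (S := S) hk he hz hs
  rw [(slotWord_none h).2.1] at h1
  rw [(slotWord_none h).2.2] at h2
  rw [located, h1, h2, Nat.zero_shiftRight]
  have : table n b S T 9 0 = 0 := popCount_zero _
  rw [this]
  exact classSelect_eq_of_lt (fun _ h => h.1) (Nat.lt_succ_self n)

lemma located_some {s a : ℕ} (hk : k < levelCount n b) (he : e ≤ n / (blockBuckets n k * b))
    (hz : z = (blocksBelow n b k + e) * (18 * b)) (hs : s < 6 * b) (hb : 0 < b)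
    (ht : t < blockBuckets n k) (h : (blockCandidates n b S k e)[s]? = some a) :
    candidateArray n b S (z + 3 * s) = a ∧
    located (table n b S T) (candidateArray n b S) t (z + 3 * s) =
      classSelect n (BucketFirst n b S) S
        (classRank n (BucketFirst n b S) S a ((e * blockBuckets n k + t) * b)) := by
  obtain ⟨h0, h1, h2⟩ := candidateArray_slot (S := S) hk he hz hs
  obtain ⟨g0, g1, g2⟩ := slotWord_some h
  refine ⟨h0.trans g0, ?_⟩
  rw [located, h1, h2, g1, g2]
  change classSelect n (BucketFirst n b S) S (_ - popCount (bitmapBits n) _) = _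
  rw [← popCount_slot a e t k hb ht, Nat.add_sub_cancel]

lemma validSlot {s : ℕ} (hk : k < levelCount n b) (he : e ≤ n / (blockBuckets n k * b))
    (hz : z = (blocksBelow n b k + e) * (18 * b)) (hs : s < 6 * b) (hb : 0 < b) (hn : 0 < n)
    (ht : t < blockBuckets n k) (hS : ∀ y, S y < 2 ^ w) :
    ValidSlot w (2 * n + 2) (table n b S T) (candidateArray n b S) t (z + 3 * s) := by
  obtain ⟨h0, h1, h2⟩ := candidateArray_slot (S := S) hk he hz hs
  cases h : (blockCandidates n b S k e)[s]? with
  | none =>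
    obtain ⟨g0, g1, g2⟩ := slotWord_none h
    refine ⟨?_, ?_, ?_, ?_⟩
    · rw [h0, g0]
      positivity
    · rw [h1, g1]
      omega
    · rw [h2, g2]
      omega
    · rw [h2, g2, Nat.zero_shiftRight]
      exact (popCount_zero _).trans_le (Nat.zero_le _)
  | some a =>
    obtain ⟨g0, g1, g2⟩ := slotWord_some h
    refine ⟨?_, ?_, ?_, ?_⟩
    · rw [h0, g0]
      have ha : a ∈ blockCandidates n b S k e := List.mem_of_getElem? h
      obtain ⟨q, -, rfl⟩ := Finset.mem_image.1
        (Finset.mem_filter.1 (Finset.mem_toList.1 ha)).1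
      exact hS q
    · rw [h1, g1]
      have := classRank_le (n := n) (F := BucketFirst n b S) (S := S) (fun _ h => h.1) a
        ((e * blockBuckets n k + blockBuckets n k) * b)
      omega
    · rw [h2, g2]
      -- A bitmap has at most `Nat.log 2 n + 1` bits, hence is less than `2 * n` or equal to no more
      -- than that power of two allows, and fits the popcount table.
      refine (bitmap_lt _ _).trans_le
        ((Nat.pow_le_pow_right (by norm_num) (min_le_right _ _)).trans ?_)
      rw [bitmapBits, pow_succ]
      have := Nat.pow_log_le_self 2 hn.ne'
      omega
    · rw [h1, h2, g1, g2, ← popCount_slot a e t k hb ht]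
      exact Nat.le_add_left _ _

/-- The position located for a reported candidate. -/
lemma located_of_reported {s : ℕ} (hk : k < levelCount n b)
    (he : e ≤ n / (blockBuckets n k * b)) (hz : z = (blocksBelow n b k + e) * (18 * b))
    (hs : s < 6 * b) (hb : 0 < b) (ht : t < blockBuckets n k) (hj : j < n)
    (h : Reported (table n b S T) (candidateArray n b S) i j m t (z + 3 * s)) :
    (e * blockBuckets n k + t) * b ≤
        located (table n b S T) (candidateArray n b S) t (z + 3 * s) ∧
      (blockCandidates n b S k e)[s]? =
        some (S (located (table n b S T) (candidateArray n b S) t (z + 3 * s))) := by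
  obtain ⟨h1, h2, -⟩ := h
  cases ha : (blockCandidates n b S k e)[s]? with
  | none =>
    rw [located_none hk he hz hs ha] at h1
    omega
  | some a =>
    obtain ⟨g1, g2⟩ := located_some (T := T) hk he hz hs hb ht ha
    set p := located (table n b S T) (candidateArray n b S) t (z + 3 * s) with hp
    have hSp : S p = a := h2.trans g1
    have := (classSelect_eq_iff (n := n) (F := BucketFirst n b S) (S := S) (a := a)
      (x := (e * blockBuckets n k + t) * b) (k := 0) (q := p) (fun _ h => h.1) (by omega)).1
      ⟨g2.symm, hSp⟩
    exact ⟨this.2.2.1, by rw [hSp]⟩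

/-- A candidate whose first occurrence from the bucket boundary on is accepted is reported. -/
lemma reported_of_accepts {s p : ℕ} (hk : k < levelCount n b)
    (he : e ≤ n / (blockBuckets n k * b)) (hz : z = (blocksBelow n b k + e) * (18 * b))
    (hs : s < 6 * b) (hb : 0 < b) (ht : t < blockBuckets n k) (hj : j < n)
    (hi : i ≤ (e * blockBuckets n k + t) * b) (hp : (e * blockBuckets n k + t) * b ≤ p)
    (hpj : p ≤ j) (hacc : Accepts (table n b S T) i j m p)
    (ha : (blockCandidates n b S k e)[s]? = some (S p)) :
    located (table n b S T) (candidateArray n b S) t (z + 3 * s) = p ∧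
      Reported (table n b S T) (candidateArray n b S) i j m t (z + 3 * s) := by
  obtain ⟨g1, g2⟩ := located_some (T := T) hk he hz hs hb ht ha
  have hleft : ∀ q, (e * blockBuckets n k + t) * b ≤ q → q < p → S q ≠ S p := fun q hq hqp =>
    ((accepts_iff (hi.trans hp) hpj hj).1 hacc).1 q (hi.trans hq) hqp
  have hloc : located (table n b S T) (candidateArray n b S) t (z + 3 * s) = p := by
    rw [g2]
    exact ((classSelect_eq_iff (n := n) (F := BucketFirst n b S) (S := S) (a := S p)
      (x := (e * blockBuckets n k + t) * b) (k := 0) (q := p) (fun _ h => h.1) (by omega)).2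
      ⟨bucketFirst_of_leftmost (by omega) hp hleft, rfl, hp,
        cnt_eq_zero.2 fun q h1 h2 h3 => hleft q h1 h2 h3.2⟩).1
  refine ⟨hloc, ?_⟩
  rw [Reported, hloc, g1]
  exact ⟨hpj, rfl, hacc⟩

end Slots

lemma mem_scanOutput {x : MWord w} :
    x ∈ scanOutput w (table n b S T) b i j m ↔
      ∃ p, i ≤ p ∧ p < nextBoundary b i ∧ p ≤ j ∧ Accepts (table n b S T) i j m p ∧
        BitVec.ofNat w (S p) = x := by
  simp only [scanOutput, List.mem_map, List.mem_filter, List.mem_range'_1, decide_eq_true_eq]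
  constructor
  · rintro ⟨p, ⟨⟨h1, h2⟩, h3⟩, h4⟩
    exact ⟨p, h1, by omega, by omega, h3, h4⟩
  · rintro ⟨p, h1, h2, h3, h4, h5⟩
    exact ⟨p, ⟨⟨h1, by omega⟩, h4⟩, h5⟩

lemma nodup_scanOutput (hj : j < n) (hS : ∀ y, S y < 2 ^ w) :
    (scanOutput w (table n b S T) b i j m).Nodup := by
  refine List.Nodup.map_on ?_ (List.Nodup.filter _ (List.nodup_range' (step := 1)))
  intro p hp q hq h
  simp only [List.mem_filter, List.mem_range'_1, decide_eq_true_eq] at hp hq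
  exact hp.2.eq hp.1.1 (by omega) hq.1.1 (by omega) hj hq.2
    ((ofNat_inj_of_lt (hS p) (hS q)).1 h)

lemma frequent_of_accepts {p : ℕ} {x : MWord w} (hip : i ≤ p) (hpj : p ≤ j) (hj : j < n)
    (hS : ∀ y, S y < 2 ^ w) (h : Accepts (table n b S T) i j m p)
    (hx : BitVec.ofNat w (S p) = x) : m < cnt (fun q => S q = x.toNat) i (j + 1) := by
  rw [← hx, toNat_ofNat_of_lt (hS p)]
  exact ((accepts_iff hip hpj hj).1 h).2

/-- The program answers queries correctly, in terms of absolute frequencies. -/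
theorem reaches_answer {c : Config w} (hb : 0 < b) (hbn : b ≤ n) (hw : 148 * n < 2 ^ w)
    (hS : ∀ y, S y < 2 ^ w) (hT : ∀ x < n, T x ≤ n) (hTb : ∀ x < n, x + 1 ≤ (T x + 1) * b)
    (hij : i ≤ j) (hj : j < n) (hc : c.IsQuery (dataWords w n b S T) i j) :
    ∃ c', queryProgram.Reaches c (267 * b) c' ∧ c'.pc = 78 ∧ c'.mem = c.mem ∧ c'.out.Nodup ∧
      ∀ x : MWord w, x ∈ c'.out ↔ T (j - i) < cnt (fun q => S q = x.toNat) i (j + 1) := by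
  have hL := layout_of_stores hc.stores hb hbn hw hS hT
  rcases lt_or_ge j (nextBoundary b i) with hshort | hlong
  · obtain ⟨c', hr, hpc, hmem, hout⟩ :=
      reaches_of_short_query hL hij hj hc.pc_eq rfl hc.reg_zero hc.reg_one hshort
    rw [hc.out_eq, List.nil_append] at hout
    change c'.out = scanOutput w _ b i j (T (j - i)) at hout
    refine ⟨c', hr.mono (by omega), hpc, hmem, hout ▸ nodup_scanOutput hj hS, fun x => ?_⟩
    rw [hout, mem_scanOutput]
    constructor
    · rintro ⟨p, h1, -, h2, h3, h4⟩
      exact frequent_of_accepts h1 h2 hj hS h3 h4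
    · intro h
      obtain ⟨p, h1, h2, h3, h4⟩ := exists_accepts (b := b) (T := T) hj h
      exact ⟨p, h1, by omega, h2, h4, by rw [h3, BitVec.ofNat_toNat, BitVec.setWidth_eq]⟩
  · set u := i / b + 1 with hu
    have hbd : nextBoundary b i = u * b := rfl
    have hlt := lt_nextBoundary (i := i) hb
    rw [hbd] at hlong hlt
    have hxn : j - u * b < n := by omega
    set k := rangeLevel b (j - u * b) with hk
    have hklt : k < levelCount n b := rangeLevel_lt hxn
    set e := u / blockBuckets n k with he
    set t := u % blockBuckets n k with ht
    -- The starting bucket `u` is bucket number `t` of block `e`.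
    have hut : e * blockBuckets n k + t = u := by
      rw [mul_comm]
      exact Nat.div_add_mod u _
    have htlt : t < blockBuckets n k := Nat.mod_lt _ (blockBuckets_pos n k)
    have hdiv : u * b / (blockBuckets n k * b) = e := Nat.mul_div_mul_right _ _ hb
    have hmod : u * b % (blockBuckets n k * b) / b = t := by
      rw [Nat.mul_mod_mul_right, Nat.mul_div_cancel _ hb]
    have hen : e ≤ n / (blockBuckets n k * b) := by
      rw [← hdiv]
      exact Nat.div_le_div_right (by omega)
    set z := (blocksBelow n b k + e) * (18 * b) with hz
    have hzZ : z + 18 * b ≤ candidateCells n b := by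
      rw [hz, candidateCells, ← Nat.succ_mul]
      refine Nat.mul_le_mul_right _ ?_
      refine le_trans ?_ (blocksBelow_mono n b (Nat.succ_le_of_lt hklt))
      rw [Nat.succ_eq_add_one k, blocksBelow_succ]
      exact Nat.succ_le_succ (Nat.add_le_add_left hen _)
    obtain ⟨c', hr, hpc, hmem, hout⟩ := reaches_of_long_query hL hij hj hc.pc_eq rfl hc.reg_zero
      hc.reg_one (p := u * b) (Q := blockBuckets n k * b) (z := z) rfl hlong rfl
      (by rw [hdiv]; rfl) hzZ
      (fun s hs => by
        rw [hmod]
        exact validSlot hklt hen rfl hs hb (by omega) htlt hS)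
    rw [hc.out_eq, List.nil_append, hmod] at hout
    change c'.out = scanOutput w _ b i j (T (j - i)) ++
      candidateOutput w _ _ (6 * b) i j (T (j - i)) t z at hout
    set m := T (j - i) with hm
    have hrep : ∀ s < 6 * b, Reported (table n b S T) (candidateArray n b S) i j m t (z + 3 * s) →
        u * b ≤ located (table n b S T) (candidateArray n b S) t (z + 3 * s) ∧
        (blockCandidates n b S k e)[s]? =
          some (S (located (table n b S T) (candidateArray n b S) t (z + 3 * s))) :=
      fun s hs h => hut ▸ located_of_reported hklt hen rfl hs hb htlt hj h
    have hmemc : ∀ x : MWord w,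
        x ∈ candidateOutput w (table n b S T) (candidateArray n b S) (6 * b) i j m t z ↔
        ∃ s < 6 * b, Reported (table n b S T) (candidateArray n b S) i j m t (z + 3 * s) ∧
          BitVec.ofNat w (S (located (table n b S T) (candidateArray n b S) t (z + 3 * s))) = x := by
      intro x
      simp only [candidateOutput, List.mem_map, List.mem_filter, List.mem_range,
        decide_eq_true_eq, and_assoc]
      rfl
    refine ⟨c', hr.mono (by omega), hpc, hmem, ?_, fun x => ?_⟩
    · rw [hout, List.nodup_append']
      refine ⟨nodup_scanOutput hj hS, ?_, ?_⟩
      · refine List.Nodup.map_on ?_ (List.Nodup.filter _ List.nodup_range)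
        intro s hs s' hs' h
        simp only [List.mem_filter, List.mem_range, decide_eq_true_eq] at hs hs'
        have h1 := (hrep s hs.1 hs.2).2
        have h2 := (hrep s' hs'.1 hs'.2).2
        have h3 : S (located (table n b S T) (candidateArray n b S) t (z + 3 * s)) =
            S (located (table n b S T) (candidateArray n b S) t (z + 3 * s')) :=
          (ofNat_inj_of_lt (hS _) (hS _)).1 h
        -- Both slots hold the same symbol, and a candidate list has no duplicates.
        rw [h3, ← h2] at h1
        refine (List.getElem?_inj ?_ (nodup_blockCandidates n b S k e)).1 h1
        by_contra hlen
        rw [← h1, List.getElem?_eq_none (not_lt.1 hlen)] at h2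
        exact absurd h2 (by simp)
      · intro x hx hx'
        obtain ⟨p, h1, h2, h3, h4, h5⟩ := mem_scanOutput.1 hx
        obtain ⟨s, h6, h7, h8⟩ := (hmemc x).1 hx'
        have h9 := (hrep s h6 h7).1
        -- A symbol has only one accepted position, but the scan stays below `u * b` while located
        -- positions do not.
        have := h4.eq h1 h3 (by omega) h7.1 hj h7.2.2
          ((ofNat_inj_of_lt (hS _) (hS _)).1 (h5.trans h8.symm))
        omega
    · rw [hout, List.mem_append, mem_scanOutput, hmemc]
      constructor
      · rintro (⟨p, h1, -, h2, h3, h4⟩ | ⟨s, h1, h2, h3⟩)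
        · exact frequent_of_accepts h1 h2 hj hS h3 h4
        · exact frequent_of_accepts (by have := (hrep s h1 h2).1; omega) h2.1 hj hS h2.2.2 h3
      · intro h
        obtain ⟨p, h1, h2, h3, h4⟩ := exists_accepts (b := b) (T := T) hj h
        have hx : BitVec.ofNat w (S p) = x := by rw [h3, BitVec.ofNat_toNat, BitVec.setWidth_eq]
        rcases lt_or_ge p (u * b) with hpu | hpu
        · exact Or.inl ⟨p, h1, hpu, h2, h4, hx⟩
        right
        -- The leftmost occurrence `p` lies beyond the boundary, so no occurrence is lost by
        -- shortening the range.
        have hcnt : cnt (fun q => S q = S p) (u * b) (j + 1) =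
            cnt (fun q => S q = S p) i (j + 1) := by
          have h0 : cnt (fun q => S q = S p) i (u * b) = 0 := cnt_eq_zero.2 fun q hq hqu =>
            ((accepts_iff h1 h2 hj).1 h4).1 q hq (hqu.trans_le hpu)
          rw [← cnt_add hlt.le (by omega : u * b ≤ j + 1), h0, zero_add]
        rw [← h3] at h
        have hcand : S p ∈ blockCandidates n b S k e := by
          refine Finset.mem_toList.2 (mem_candidates hb (x := u * b) hj hlong rfl ?_ ?_ ?_ ?_)
          · refine Nat.mul_le_mul_right b ?_
            omega
          · rw [← add_mul]
            refine Nat.mul_lt_mul_of_pos_right ?_ hb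
            have := htlt.trans_le (min_le_left _ _)
            omega
          · rw [hcnt]
            omega
          · rw [hcnt]
            -- The threshold for the full length `j - i + 1` is more than enough for the shorter
            -- range.
            have h5 := hTb (j - i) (by omega)
            have h6 := Nat.mul_le_mul_right b (Nat.succ_le_of_lt h)
            simp only [Nat.succ_eq_add_one, ← hm] at h5 h6
            omega
        obtain ⟨s, hs, hget⟩ := List.mem_iff_getElem.1 hcand
        have hget' : (blockCandidates n b S k e)[s]? = some (S p) := by
          rw [List.getElem?_eq_getElem hs, hget]
        have hs6 : s < 6 * b := by
          refine hs.trans_le ?_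
          rw [blockCandidates, Finset.length_toList]
          exact card_candidates_le _ _ _ _ _
        obtain ⟨g1, g2⟩ := reported_of_accepts (T := T) (m := m) (i := i) (j := j) hklt hen hz hs6 hb
          htlt hj (hut.symm ▸ hlt.le) (hut.symm ▸ hpu) h2 h4 hget'
        exact ⟨s, hs6, g2, by rw [g1, hx]⟩

end Correct

/-! ### From relative to absolute frequencies -/

/-- A string as a function on all natural numbers. -/
def symbolAt {n w : ℕ} (S : Fin n → MWord w) (q : ℕ) : ℕ := if h : q < n then (S ⟨q, h⟩).toNat else 0

lemma symbolAt_lt {n w : ℕ} (S : Fin n → MWord w) (q : ℕ) : symbolAt S q < 2 ^ w := by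
  unfold symbolAt
  split_ifs
  · exact BitVec.isLt _
  · positivity

lemma occ_eq_cnt {n w : ℕ} (S : Fin n → MWord w) (i j : Fin n) (a : MWord w) :
    occ S i j a = cnt (fun q => symbolAt S q = a.toNat) i (j + 1) := by
  classical
  unfold occ cnt
  refine Finset.card_bij (fun q _ => (q : ℕ)) ?_ (fun _ _ _ _ h => Fin.ext h) ?_
  · intro q hq
    simp only [Finset.mem_filter, Finset.mem_Icc, Finset.mem_Ico] at hq ⊢
    refine ⟨⟨hq.1.1, Nat.lt_succ_of_le hq.1.2⟩, ?_⟩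
    rw [symbolAt, dif_pos q.2, ← hq.2]
  · intro q hq
    simp only [Finset.mem_filter, Finset.mem_Ico] at hq
    have hqn : q < n := by omega
    refine ⟨⟨q, hqn⟩, ?_, rfl⟩
    rw [symbolAt, dif_pos hqn, BitVec.toNat_inj] at hq
    simp only [Finset.mem_filter, Finset.mem_Icc, Fin.le_def]
    exact ⟨⟨hq.1.1, by omega⟩, hq.2⟩

/-- One less than the number of occurrences required in a range of length `x + 1`. -/
noncomputable def requiredPred (τ : ℝ) (x : ℕ) : ℕ := ⌈τ * (x + 1)⌉₊ - 1

lemma requiredPred_add_one {τ : ℝ} (h : 0 < τ) (x : ℕ) :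
    requiredPred τ x + 1 = ⌈τ * (x + 1)⌉₊ :=
  Nat.sub_add_cancel (Nat.ceil_pos.2 (by positivity))

/-- Thresholds below `1 / n` may be replaced by `1 / n`. -/
lemma isRangeMajority_iff {n w : ℕ} {τ : ℝ} (hτ : 0 < τ) (S : Fin n → MWord w) {i j : Fin n}
    (hij : i ≤ j) (a : MWord w) :
    IsRangeMajority τ S i j a ↔ requiredPred (max τ (1 / n)) (j - i) <
      cnt (fun q => symbolAt S q = a.toNat) i (j + 1) := by
  have hij' : (i : ℕ) ≤ j := hij
  have hn : (0 : ℝ) < n := by exact_mod_cast i.pos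
  rw [← occ_eq_cnt, ← Nat.succ_le_iff, Nat.succ_eq_add_one,
    requiredPred_add_one (lt_max_of_lt_left hτ), Nat.ceil_le, IsRangeMajority,
    Nat.cast_sub hij']
  have hL : (0 : ℝ) < (j : ℝ) - i + 1 := by
    have : ((i : ℕ) : ℝ) ≤ (j : ℕ) := by exact_mod_cast hij'
    linarith
  rw [le_div_iff₀ hL, max_mul_of_nonneg _ _ hL.le, max_le_iff, iff_self_and]
  -- Only the bound coming from `1 / n` is left: a majority occurs at least once, and the range has
  -- at most `n` positions.
  intro h
  have h1 : (1 : ℝ) ≤ occ S i j a := by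
    have : (0 : ℝ) < occ S i j a := (mul_pos hτ hL).trans_le h
    exact_mod_cast this
  refine le_trans ?_ h1
  rw [div_mul_eq_mul_div, one_mul, div_le_one hn]
  have h2 : ((j : ℕ) : ℝ) + 1 ≤ n := by exact_mod_cast j.2
  have h3 : (0 : ℝ) ≤ ((i : ℕ) : ℝ) := Nat.cast_nonneg _
  linarith

/-- Linear space and query time proportional to `1 / τ`. -/
theorem exists_supportsRangeMajority {τ : ℝ} (hτ : 0 < τ) (hτ1 : τ ≤ 1) {n w : ℕ}
    (hw : 149 * n ≤ 2 ^ w) (S : Fin n → MWord w) :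
    ∃ D : List (MWord w), D.length ≤ 148 * n ∧ D.length ≤ 2 ^ w ∧
      queryProgram.SupportsRangeMajority D τ S (534 * (1 / τ)) := by
  rcases Nat.eq_zero_or_pos n with rfl | hn
  · exact ⟨[], by simp, by simp, fun i => i.elim0⟩
  have hn' : (1 : ℝ) ≤ n := by exact_mod_cast hn
  -- The cutoff keeps the bucket size at most `n`, hence the space linear with a constant
  -- independent of `τ`.
  set σ := max τ (1 / n) with hσ
  have hσ0 : 0 < σ := lt_max_of_lt_left hτ
  have hσ1 : σ ≤ 1 := max_le hτ1 (div_le_one_of_le₀ hn' (by linarith))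
  set b := ⌈1 / σ⌉₊ with hb
  have hb0 : 0 < b := Nat.ceil_pos.2 (by positivity)
  have hσn : 1 / σ ≤ n := by
    rw [div_le_iff₀ hσ0]
    have : (1 : ℝ) / n ≤ σ := le_max_right _ _
    rw [div_le_iff₀ (by linarith)] at this
    linarith
  have hbn : b ≤ n := Nat.ceil_le.2 hσn
  have hb1 : 1 / σ ≤ b := Nat.le_ceil _
  -- Rounding up adds less than `1 ≤ 1 / τ`; the time bound `267 * b` thus becomes `534 / τ`.
  have hb2 : (b : ℝ) ≤ 2 * (1 / τ) := by
    have h1 : (b : ℝ) < 1 / σ + 1 := Nat.ceil_lt_add_one (by positivity)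
    have h2 : 1 / σ ≤ 1 / τ := one_div_le_one_div_of_le hτ (le_max_left _ _)
    have h3 : 1 ≤ 1 / τ := one_le_one_div hτ hτ1
    linarith
  have hT : ∀ x < n, requiredPred σ x ≤ n := fun x hx => by
    have : ⌈σ * (x + 1)⌉₊ ≤ x + 1 := by
      refine Nat.ceil_le.2 ?_
      push_cast
      exact mul_le_of_le_one_left (by positivity) hσ1
    rw [← requiredPred_add_one hσ0] at this
    omega
  have hTb : ∀ x < n, x + 1 ≤ (requiredPred σ x + 1) * b := fun x _ => by
    rw [requiredPred_add_one hσ0]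
    have h1 : σ * (x + 1) ≤ (⌈σ * ((x : ℝ) + 1)⌉₊ : ℝ) := Nat.le_ceil _
    have h2 : ((x : ℝ) + 1) ≤ (⌈σ * ((x : ℝ) + 1)⌉₊ : ℝ) * b := by
      calc ((x : ℝ) + 1) = σ * (x + 1) * (1 / σ) := by field_simp
        _ ≤ _ := mul_le_mul h1 hb1 (by positivity) (by positivity)
    exact_mod_cast h2
  have hsize := size_le hn hbn
  have hlen : (dataWords w n b (symbolAt S) (requiredPred σ)).length =
      10 * (2 * n + 2) + candidateCells n b := by simp [dataWords]
  refine ⟨dataWords w n b (symbolAt S) (requiredPred σ), by omega, by omega, fun i j hij c hc => ?_⟩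
  obtain ⟨c', ⟨t, ht, rfl⟩, hpc, hmem, hnodup, hout⟩ := reaches_answer hb0 hbn (by omega)
    (symbolAt_lt S) hT hTb hij j.2 hc
  refine ⟨t, ?_, ⟨?_, hnodup, fun a => ?_⟩, fun k hk => ?_⟩
  · have : (t : ℝ) ≤ 267 * b := by exact_mod_cast ht
    linarith
  · rw [Program.Halted, Program.current, hpc]
    rfl
  · rw [hout, isRangeMajority_iff hτ S hij]
  · rw [hmem]
    exact hc.stores k hk

/-! ### The lower bound -/

lemma Program.length_out_run_le {w : ℕ} (P : Program) (c : Config w) (t : ℕ) :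
    (P.run c t).out.length ≤ c.out.length + t := by
  induction t generalizing c with
  | zero => exact le_rfl
  | succ t ih =>
    rw [Program.run_succ]
    have : (P.step c).out.length ≤ c.out.length + 1 := by
      unfold Program.step
      cases P.current c <;> simp [Instr.exec]
    have := ih (P.step c)
    omega

/-- The first `⌊1 / τ⌋` positions of a string of distinct symbols have as many majorities. -/
theorem exists_range_requiring_time {τ : ℝ} (hτ : 0 < τ) (hτ1 : τ ≤ 1) {n w : ℕ}
    (hn : 1 / τ ≤ n) (hw : n ≤ 2 ^ w) :
    ∃ (S : Fin n → MWord w) (i j : Fin n), i ≤ j ∧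
      ∀ (P : Program) (c : Config w) (t : ℕ), c.out = [] →
        P.AnswersWithin c t τ S i j → (1 / τ) / 2 ≤ (t : ℝ) := by
  classical
  set L := ⌊1 / τ⌋₊ with hL
  have hτ1' : 1 ≤ 1 / τ := one_le_one_div hτ hτ1
  have hL1 : 1 ≤ L := Nat.le_floor (by exact_mod_cast hτ1')
  have hLn : L ≤ n := by
    have : (L : ℝ) ≤ n := (Nat.floor_le (by positivity)).trans hn
    exact_mod_cast this
  refine ⟨fun k => BitVec.ofNat w k, ⟨0, by omega⟩, ⟨L - 1, by omega⟩, Nat.zero_le _,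
    fun P c t hc hans => ?_⟩
  have hmem : (Finset.range L).image (BitVec.ofNat w) ⊆ (P.run c t).out.toFinset := by
    intro a ha
    obtain ⟨k, hk, rfl⟩ := Finset.mem_image.1 ha
    rw [Finset.mem_range] at hk
    rw [List.mem_toFinset, hans.2.2, IsRangeMajority]
    have hocc : 1 ≤ occ (fun k : Fin n => BitVec.ofNat w k) ⟨0, by omega⟩ ⟨L - 1, by omega⟩
        (BitVec.ofNat w k) := by
      refine Finset.card_pos.2 ⟨⟨k, by omega⟩, ?_⟩
      simp only [Finset.mem_filter, Finset.mem_Icc, Fin.mk_le_mk, and_true]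
      omega
    have hL0 : (0 : ℝ) < L := by exact_mod_cast hL1
    have hcast : ((L - 1 : ℕ) : ℝ) - ((0 : ℕ) : ℝ) + 1 = L := by
      push_cast [Nat.cast_sub hL1]
      ring
    rw [hcast, le_div_iff₀ hL0]
    have h1 : (L : ℝ) ≤ 1 / τ := Nat.floor_le (by positivity)
    rw [le_div_iff₀ hτ] at h1
    -- One occurrence suffices: the range has `L ≤ 1 / τ` positions, so `τ * L ≤ 1`.
    have h2 : (1 : ℝ) ≤ _ := Nat.one_le_cast.2 hocc
    linarith
  have hcard := Finset.card_le_card hmem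
  rw [Finset.card_image_of_injOn, Finset.card_range] at hcard
  swap
  · intro x hx y hy h
    simp only [Finset.coe_range, Set.mem_Iio] at hx hy
    exact (ofNat_inj_of_lt (by omega) (by omega)).1 h
  have hlen := P.length_out_run_le c t
  rw [hc, List.length_nil, zero_add] at hlen
  have hLt : (L : ℝ) ≤ t := by
    exact_mod_cast hcard.trans ((List.toFinset_card_le _).trans hlen)
  -- The factor one half absorbs the rounding: `1 / τ < L + 1 ≤ 2 * L`.
  have h1 : 1 / τ < L + 1 := Nat.lt_floor_add_one _
  have h2 : (1 : ℝ) ≤ L := by exact_mod_cast hL1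
  linarith

theorem mainTheorem1 :
    -- linear space and `O(1 / τ)` query time
    (∃ (P : Program) (cword cspace ctime : ℕ),
      ∀ τ : ℝ, 0 < τ → τ ≤ 1 →
      ∀ n w : ℕ, cword * n ≤ 2 ^ w →
      ∀ S : Fin n → MWord w,
      ∃ D : List (MWord w),
        D.length ≤ cspace * n ∧ D.length ≤ 2 ^ w ∧
        P.SupportsRangeMajority D τ S (ctime * (1 / τ))) ∧
    -- the query time is worst-case optimal
    (∀ τ : ℝ, 0 < τ → τ ≤ 1 →
      ∀ n w : ℕ, 1 / τ ≤ (n : ℝ) → n ≤ 2 ^ w →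
      ∃ (S : Fin n → MWord w) (i j : Fin n), i ≤ j ∧
        ∀ (P : Program) (c : Config w) (t : ℕ), c.out = [] →
          P.AnswersWithin c t τ S i j → (1 / τ) / 2 ≤ (t : ℝ)) := 
  ⟨⟨queryProgram, 149, 148, 534, fun _ hτ hτ1 _ _ hw S =>
      exists_supportsRangeMajority hτ hτ1 hw S⟩,
    fun _ hτ hτ1 _ _ hn hw => exists_range_requiring_time hτ hτ1 hn hw⟩
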